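/- **Setting.** Let $Y\subseteq\mathbb R^{d'}$ be closed and convex, $Z=\mathbb R^d\times Y$, $f:\mathbb R^d\times\mathbb R^{d'}\to\mathbb R$ differentiable in $x$ and in $y$ at the points of $Z$, $F(x,y)=(\nabla_xf(x,y),-\nabla_yf(x,y))$, $P(x)=\max_{y\in Y}f(x,y)$ and $\mathrm{Gap}(x,y)=\max_{y'\in Y}f(x,y')-\min_{x'\in\mathbb R^d}f(x',y)$. A function $h$ on $\mathbb R^d$ is called $\mu$-PL if it has a global minimizer $x_*$ and $\|\nabla h(x)\|^2\ge2\mu(h(x)-h(x_*))$ for all $x$. Let $\mu,\mu_x,\mu_y>0$ and assume: $F$ is $\ell$-Lipschitz on $Z$; $f(x,\cdot)$ is $\mu_y$-strongly concave on $Y$ for every $x$; $P$ is differentiable with $L$-Lipschitz gradient and is $\mu$-PL; $f(\cdot,y)$ is $\mu_x$-PL for every $y\in Y$; $f(\cdot,y)$ is $\rho$-weakly convex for every $y\in Y$, where $0<\rho\le\ell$ and $\rho\le\mu/8$; and $(x_0,y_0)\in Z$ satisfies $\mathrm{Gap}(x_0,y_0)\le\epsilon_0$. The function $f$ is accessed through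 stochastic gradients $\mathcal G(z;\xi)$, jointly measurable in $(z,\xi)$, with independent samples $\xi^k_t$ and $\mathbb E[\mathcal G(z;\xi^k_t)]=F(z)$ for all $z\in Z$. **Algorithm (PES-AdaGrad).** Let $\delta>0$, $\alpha\in(0,1/2]$. Given step sizes $\eta_k>0$ and integers $T_k\ge1$ fixed in advance, epoch $k=1,\dots,K$ computes $z_k=(x_k,y_k)$ from $z_{k-1}=(x_{k-1},y_{k-1})$ by $T_k$ steps of AdaGrad on $f_k(x,y)=f(x,y)+\frac\gamma2\|x-x_{k-1}\|^2$, $\gamma=\mu/4$. That is, with $z^k_1=z_{k-1}$ and $g^k_t=\mathcal G(z^k_t;\xi^k_t)+(\gamma(x^k_t-x_{k-1}),0)$, let $\|g^k_{1:t,i}\|_2$ be the Euclidean norm of the vector of the $i$-th coordinates of $g^k_1,\dots,g^k_t$, let $H_t=\delta I+\mathrm{diag}_i(\|g^k_{1:t,i}\|_2)$, and $$z^k_{t+1}=\arg\min_{z\in Z}\ \eta_k\Big\langle z,\frac1t\sum_{\tau\le t}g^k_\tau\Big\rangle+\frac1{2t}\langle z-z_{k-1},H_t(z-z_{k-1})\rangle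 ,\qquad z_k=\frac1{T_k}\sum_{t=1}^{T_k}z^k_t .$$ For $\eta_0>0$ put $m=1/\sqrt{d+d'}$, $\eta_k=\eta_0e^{-(k-1)/32}$, $M_k=\frac{384\,m}{\eta_0\min\{\mu/8,\mu_y\}}e^{(k-1)/32}$ and $T_k^*=\big\lceil(2\sqrt{d+d'}\,\delta M_k)^{1/(1-\alpha)}\big\rceil$. **Claim.** There is a universal constant $C>0$ such that for all $d,d'$, $\mu,\mu_x,\mu_y,\delta,\epsilon>0$, $\alpha\in(0,1/2]$, $\epsilon_0\ge0$ there are $\eta_0>0$ and an integer $K\ge0$, depending only on these quantities, with $$\sum_{k=1}^KT_k^*\le C\,\Big(1+\log\Big(1+\Big(\frac\mu{\mu_x}+1\Big)\frac{\epsilon_0}\epsilon\Big)\Big)\max\Big\{1,\Big(\frac{\mu}{\mu_x}+1\Big)\Big(\frac{\delta^2(d+d')}{\min\{\mu,\mu_y\}\,\epsilon}\Big)^{\frac1{2(1-\alpha)}}\Big\},$$ that is, $\widetilde O\Big(\big(\frac{\mu}{\mu_x}+1\big)\big(\frac{\delta^2(d+d')}{\min\{\mu,\mu_y\}\epsilon}\big)^{\frac1{2(1-\alpha)}}\Big)$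 iterations in total, and such that for every problem in the setting above: 1. If the algorithm is run with $T_k=T_k^*$, and almost surely $\|g^k_t\|_\infty\le\delta$ and $\|g^k_{1:T_k,i}\|_2\le\delta T_k^\alpha$ for all $k\le K$, $t\le T_k$ and all $i$, then $\mathrm{Gap}(x_K,y_K)$ is integrable and $\mathbb E[\mathrm{Gap}(x_K,y_K)]\le\epsilon$. 2. The same conclusion holds with any other fixed $T_k\ge1$ if almost surely $\|g^k_t\|_\infty\le\delta$ and $T_k\ge M_k\max\big\{\frac{\delta+\max_i\|g^k_{1:T_k,i}\|_2}{m},\,m\sum_i\|g^k_{1:T_k,i}\|_2\big\}$ for all $k\le K$, $t\le T_k$. -/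

import Mathlib

open MeasureTheory ProbabilityTheory

noncomputable section

namespace PesAdaGrad

/-- `ℝⁿ` with the Euclidean norm. -/
abbrev Vec (n : ℕ) := EuclideanSpace ℝ (Fin n)

/-- `ℝ^(d+d')` with the Euclidean norm; its points are the pairs `z = (x, y)`. -/
abbrev Joint (d d' : ℕ) := EuclideanSpace ℝ (Fin d ⊕ Fin d')

variable {d d' : ℕ}

/-- The pair `(x, y)` as a point of `ℝ^(d+d')`. -/
def join (x : Vec d) (y : Vec d') : Joint d d' :=
  WithLp.toLp 2 (Sum.elim (fun i => x i) (fun j => y j))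

/-- The `x`-block of `z`. -/
def xPart (z : Joint d d') : Vec d := WithLp.toLp 2 (fun i => z (Sum.inl i))

/-- The `y`-block of `z`. -/
def yPart (z : Joint d d') : Vec d' := WithLp.toLp 2 (fun j => z (Sum.inr j))

/-- The feasible set `Z = ℝᵈ × Y`. -/
def feasible (Y : Set (Vec d')) : Set (Joint d d') := {z | yPart z ∈ Y}

/-- `∇ₓ f(x, y)`. -/
def gradX (f : Vec d → Vec d' → ℝ) (x : Vec d) (y : Vec d') : Vec d :=
  gradient (fun x' => f x' y) x

/-- `∇_y f(x, y)`. -/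
def gradY (f : Vec d → Vec d' → ℝ) (x : Vec d) (y : Vec d') : Vec d' :=
  gradient (fun y' => f x y') y

/-- The gradient field `F(z) = (∇ₓ f(x, y), -∇_y f(x, y))`. -/
def field (f : Vec d → Vec d' → ℝ) (z : Joint d d') : Joint d d' :=
  join (gradX f (xPart z) (yPart z)) (-gradY f (xPart z) (yPart z))

/-- The primal objective `P(x) = max_{y ∈ Y} f(x, y)`. -/
def primal (Y : Set (Vec d')) (f : Vec d → Vec d' → ℝ) (x : Vec d) : ℝ :=
  sSup ((fun y => f x y) '' Y)

/-- The duality gap `max_{y' ∈ Y} f(x, y') - min_{x'} f(x', y)`. -/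
def dualityGap (Y : Set (Vec d')) (f : Vec d → Vec d' → ℝ) (x : Vec d) (y : Vec d') : ℝ :=
  primal Y f x - sInf (Set.range (fun x' => f x' y))

/-- The Polyak-Lojasiewicz condition on `ℝⁿ`: `h` has a global minimizer `x_*` and
`‖∇h(x)‖² ≥ 2 μ (h(x) - h(x_*))` for all `x`. -/
def IsPL {n : ℕ} (h : Vec n → ℝ) (μ : ℝ) : Prop :=
  ∃ xs : Vec n, (∀ x, h xs ≤ h x) ∧ ∀ x, 2 * μ * (h x - h xs) ≤ ‖gradient h x‖ ^ 2

/-- The assumptions on the problem `min_x max_{y ∈ Y} f(x, y)`. -/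
structure IsProblem (Y : Set (Vec d')) (f : Vec d → Vec d' → ℝ) (ℓ L ρ μ μx μy : ℝ) :
    Prop where
  closed : IsClosed Y
  convex : Convex ℝ Y
  diff_x : ∀ x, ∀ y ∈ Y, DifferentiableAt ℝ (fun x' => f x' y) x
  diff_y : ∀ x, ∀ y ∈ Y, DifferentiableAt ℝ (fun y' => f x y') y
  /-- `F` is `ℓ`-Lipschitz on `Z`. -/
  lipschitz : ∀ z ∈ feasible (d := d) Y, ∀ z' ∈ feasible (d := d) Y,
    ‖field f z - field f z'‖ ≤ ℓ * ‖z - z'‖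
  /-- `f` is `μ_y`-strongly concave in `y`. -/
  strongConcave : ∀ x, StrongConcaveOn Y μy (fun y => f x y)
  /-- `P` is `L`-smooth. -/
  primal_diff : Differentiable ℝ (primal Y f)
  primal_smooth : ∀ x x', ‖gradient (primal Y f) x - gradient (primal Y f) x'‖ ≤ L * ‖x - x'‖
  /-- `P` satisfies the `μ`-PL condition; in particular it has a global minimizer. -/
  primal_PL : IsPL (primal Y f) μ
  /-- `f(·, y)` satisfies the `μ_x`-PL condition for every `y ∈ Y`. -/
  xside_PL : ∀ y ∈ Y, IsPL (fun x => f x y) μx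
  /-- `f(·, y)` is `ρ`-weakly convex for every `y ∈ Y`. -/
  weakConvex : ∀ y ∈ Y, ∀ x x',
    inner ℝ (gradX f x' y) (x - x') - ρ / 2 * ‖x - x'‖ ^ 2 ≤ f x y - f x' y

/-- A stochastic first-order oracle: `G z s` is the stochastic gradient at `z` for the sample `s`
(with the sign convention of `field`), and the samples `ξ k t` used in epoch `k` at step `t` are
independent and make it unbiased. -/
structure IsOracle {Ω Ξ : Type*} [MeasurableSpace Ω] [MeasurableSpace Ξ] (prob : Measure Ω)
    (Y : Set (Vec d')) (f : Vec d → Vec d' → ℝ) (G : Joint d d' → Ξ → Joint d d')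
    (ξ : ℕ → ℕ → Ω → Ξ) : Prop where
  measurable_oracle : Measurable (Function.uncurry G)
  measurable_sample : ∀ k t, Measurable (ξ k t)
  indep : iIndepFun (fun (p : ℕ × ℕ) => ξ p.1 p.2) prob
  integrable : ∀ k t, ∀ z ∈ feasible Y, Integrable (fun ω => G z (ξ k t ω)) prob
  unbiased : ∀ k t, ∀ z ∈ feasible Y, ∫ ω, G z (ξ k t ω) ∂prob = field f z

/-- A minimizer of `φ` over `s` (an arbitrary point if there is none). -/
def argminOn (s : Set (Joint d d')) (φ : Joint d d' → ℝ) : Joint d d' :=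
  Classical.epsilon (fun z => z ∈ s ∧ ∀ w ∈ s, φ z ≤ φ w)

/-- State of the AdaGrad min-max method after `t` steps: the iterate `z_{t+1}`, the sum of the
stochastic gradients `g_1, …, g_t`, and their coordinatewise sums of squares. -/
structure AdaState (d d' : ℕ) where
  z : Joint d d'
  gsum : Joint d d'
  gsq : Fin d ⊕ Fin d' → ℝ

/-- The AdaGrad min-max method started at `z₀` (so `z_1 = z_0`). At step `t = n + 1` it queries
`g_t = g t z_t`, sets `s_{t,i} = ‖g_{1:t,i}‖₂`, `H_t = δ I + diag(s_t)`,
`ψ_t(z) = ½ ⟨z - z_0, H_t (z - z_0)⟩`, and takes for `z_{t+1}` the minimizer over `Z` of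
`η ⟨z, (1/t) ∑_{τ ≤ t} g_τ⟩ + (1/t) ψ_t(z)`. -/
def adaState (Z : Set (Joint d d')) (g : ℕ → Joint d d' → Joint d d') (δ η : ℝ)
    (z₀ : Joint d d') : ℕ → AdaState d d'
  | 0 => ⟨z₀, 0, 0⟩
  | n + 1 =>
    let S := adaState Z g δ η z₀ n
    let v := g (n + 1) S.z
    let gsum := S.gsum + v
    let gsq := fun i => S.gsq i + v i ^ 2
    let ψ := fun z : Joint d d' => 1 / 2 * ∑ i, (δ + √(gsq i)) * (z i - z₀ i) ^ 2
    let t : ℝ := n + 1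
    ⟨argminOn Z (fun z => η * inner ℝ z ((1 / t) • gsum) + 1 / t * ψ z), gsum, gsq⟩

/-- The iterate `z_t`, `t ≥ 1`. -/
def adaIter (Z : Set (Joint d d')) (g : ℕ → Joint d d' → Joint d d') (δ η : ℝ)
    (z₀ : Joint d d') (t : ℕ) : Joint d d' := (adaState Z g δ η z₀ (t - 1)).z

/-- The stochastic gradient `g_t` at `z_t`, `t ≥ 1`. -/
def adaGrad (Z : Set (Joint d d')) (g : ℕ → Joint d d' → Joint d d') (δ η : ℝ)
    (z₀ : Joint d d') (t : ℕ) : Joint d d' := g t (adaIter Z g δ η z₀ t)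

/-- `‖g_{1:T,i}‖₂`, the Euclidean norm of the `i`-th coordinates of `g_1, …, g_T`. -/
def adaNorm (Z : Set (Joint d d')) (g : ℕ → Joint d d' → Joint d d') (δ η : ℝ)
    (z₀ : Joint d d') (T : ℕ) (i : Fin d ⊕ Fin d') : ℝ :=
  √(∑ t ∈ Finset.Icc 1 T, adaGrad Z g δ η z₀ t i ^ 2)

/-- The output `(1/T) ∑_{t=1}^T z_t`. -/
def adaAverage (Z : Set (Joint d d')) (g : ℕ → Joint d d' → Joint d d') (δ η : ℝ)
    (z₀ : Joint d d') (T : ℕ) : Joint d d' :=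
  (1 / (T : ℝ)) • ∑ t ∈ Finset.Icc 1 T, adaIter Z g δ η z₀ t

theorem adaState_gsum (Z : Set (Joint d d')) (g : ℕ → Joint d d' → Joint d d') (δ η : ℝ)
    (z₀ : Joint d d') (n : ℕ) :
    (adaState Z g δ η z₀ n).gsum = ∑ t ∈ Finset.Icc 1 n, adaGrad Z g δ η z₀ t := by
  induction n with
  | zero => simp [adaState]
  | succ n ih =>
    rw [Finset.sum_Icc_succ_top (by omega), ← ih]
    rfl

/-- The weights used by the method are the norms `‖g_{1:t,i}‖₂`. -/
theorem sqrt_adaState_gsq (Z : Set (Joint d d')) (g : ℕ → Joint d d' → Joint d d') (δ η : ℝ)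
    (z₀ : Joint d d') (n : ℕ) (i : Fin d ⊕ Fin d') :
    √((adaState Z g δ η z₀ n).gsq i) = adaNorm Z g δ η z₀ n i := by
  have h : (adaState Z g δ η z₀ n).gsq i
      = ∑ t ∈ Finset.Icc 1 n, adaGrad Z g δ η z₀ t i ^ 2 := by
    induction n with
    | zero => simp [adaState]
    | succ n ih =>
      rw [Finset.sum_Icc_succ_top (by omega), ← ih]
      rfl
  rw [h]
  rfl

/-- The stochastic gradient, at step `t`, of the proximal objective
`f(x, y) + (γ/2) ‖x - x_ref‖²`. -/
def proxOracle {Ξ : Type*} (G : Joint d d' → Ξ → Joint d d') (γ : ℝ) (zref : Joint d d')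
    (ξ : ℕ → Ξ) (t : ℕ) (z : Joint d d') : Joint d d' :=
  G z (ξ t) + join (γ • (xPart z - xPart zref)) 0

/-- The parameters of the proximal epoch stochastic method. -/
structure Params where
  /-- proximal weight -/
  γ : ℝ
  /-- AdaGrad regularization -/
  δ : ℝ
  /-- step size of each epoch -/
  η : ℕ → ℝ
  /-- number of AdaGrad steps in each epoch -/
  T : ℕ → ℕ

/-- The proximal epoch stochastic method with AdaGrad updates, on the sample path `ξ`:
`pes … k` is `(x_k, y_k)`, obtained from `(x_{k-1}, y_{k-1})` by running AdaGrad from that point on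
`f_k(x, y) = f(x, y) + (γ/2) ‖x - x_{k-1}‖²` and averaging. -/
def pes {Ξ : Type*} (Y : Set (Vec d')) (G : Joint d d' → Ξ → Joint d d') (p : Params)
    (z₀ : Joint d d') (ξ : ℕ → ℕ → Ξ) : ℕ → Joint d d'
  | 0 => z₀
  | k + 1 =>
    let zref := pes Y G p z₀ ξ k
    adaAverage (feasible Y) (proxOracle G p.γ zref (ξ (k + 1))) p.δ (p.η (k + 1)) zref
      (p.T (k + 1))

/-- The stochastic gradient used at step `t` of epoch `k`, `k ≥ 1`. -/
def epochGrad {Ξ : Type*} (Y : Set (Vec d')) (G : Joint d d' → Ξ → Joint d d') (p : Params)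
    (z₀ : Joint d d') (ξ : ℕ → ℕ → Ξ) (k t : ℕ) : Joint d d' :=
  let zref := pes Y G p z₀ ξ (k - 1)
  adaGrad (feasible Y) (proxOracle G p.γ zref (ξ k)) p.δ (p.η k) zref t

/-- `‖g^k_{1:T_k,i}‖₂`. -/
def epochNorm {Ξ : Type*} (Y : Set (Vec d')) (G : Joint d d' → Ξ → Joint d d') (p : Params)
    (z₀ : Joint d d') (ξ : ℕ → ℕ → Ξ) (k : ℕ) (i : Fin d ⊕ Fin d') : ℝ :=
  √(∑ t ∈ Finset.Icc 1 (p.T k), epochGrad Y G p z₀ ξ k t i ^ 2)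

/-- Every coordinate of every stochastic gradient of the first `K` epochs is at most `δ` in
absolute value, almost surely. -/
def GradBounded {Ω Ξ : Type*} [MeasurableSpace Ω] (prob : Measure Ω) (Y : Set (Vec d'))
    (G : Joint d d' → Ξ → Joint d d') (p : Params) (z₀ : Joint d d') (ξ : ℕ → ℕ → Ω → Ξ)
    (K : ℕ) : Prop :=
  ∀ᵐ ω ∂prob, ∀ k ∈ Finset.Icc 1 K, ∀ t ∈ Finset.Icc 1 (p.T k), ∀ i,
    |epochGrad Y G p z₀ (fun k t => ξ k t ω) k t i| ≤ p.δ

/-- Growth condition: `‖g^k_{1:T_k,i}‖₂ ≤ δ T_k^α` in the first `K` epochs, almost surely. -/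
def GradGrowth {Ω Ξ : Type*} [MeasurableSpace Ω] (prob : Measure Ω) (Y : Set (Vec d'))
    (G : Joint d d' → Ξ → Joint d d') (p : Params) (z₀ : Joint d d') (ξ : ℕ → ℕ → Ω → Ξ)
    (K : ℕ) (α : ℝ) : Prop :=
  ∀ᵐ ω ∂prob, ∀ k ∈ Finset.Icc 1 K, ∀ i,
    epochNorm Y G p z₀ (fun k t => ξ k t ω) k i ≤ p.δ * (p.T k : ℝ) ^ α

/-- `m = 1 / √(d + d')`. -/
def mConst (d d' : ℕ) : ℝ := 1 / √((d : ℝ) + d')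

/-- `η_k = η₀ exp(-(k-1)/32)`. -/
def stepSize (η₀ : ℝ) (k : ℕ) : ℝ := η₀ * Real.exp (-((k : ℝ) - 1) / 32)

/-- `M_k = 384 m / (η₀ min{μ/8, μ_y}) exp((k-1)/32)`. -/
def budget (d d' : ℕ) (μ μy η₀ : ℝ) (k : ℕ) : ℝ :=
  384 * mConst d d' / (η₀ * min (μ / 8) μy) * Real.exp (((k : ℝ) - 1) / 32)

/-- Epoch-length rule: almost surely, in each of the first `K` epochs,
`T_k ≥ M_k max{(δ + max_i ‖g^k_{1:T_k,i}‖₂) / m, m ∑_i ‖g^k_{1:T_k,i}‖₂}`. -/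
def LengthRule {Ω Ξ : Type*} [MeasurableSpace Ω] (prob : Measure Ω) (Y : Set (Vec d'))
    (G : Joint d d' → Ξ → Joint d d') (p : Params) (z₀ : Joint d d') (ξ : ℕ → ℕ → Ω → Ξ)
    (K : ℕ) (M : ℕ → ℝ) : Prop :=
  ∀ᵐ ω ∂prob, ∀ k ∈ Finset.Icc 1 K,
    M k * max
      ((p.δ + ⨆ i, epochNorm Y G p z₀ (fun k t => ξ k t ω) k i) / mConst d d')
      (mConst d d' * ∑ i, epochNorm Y G p z₀ (fun k t => ξ k t ω) k i) ≤ p.T k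

/-- `T_k = ⌈(2 √(d+d') δ M_k)^(1/(1-α))⌉`. -/
def epochLength (d d' : ℕ) (μ μy δ α η₀ : ℝ) (k : ℕ) : ℕ :=
  ⌈(2 * √((d : ℝ) + d') * δ * budget d d' μ μy η₀ k) ^ (1 / (1 - α))⌉₊

/-- The parameters `γ = μ/4`, `η_k = η₀ exp(-(k-1)/32)` with epoch lengths `T`. -/
def params (μ δ η₀ : ℝ) (T : ℕ → ℕ) : Params := ⟨μ / 4, δ, stepSize η₀, T⟩

/-- The expected duality gap of `(x_K, y_K)` is well defined and at most `ε`. -/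
def ReachesGap {Ω Ξ : Type*} [MeasurableSpace Ω] (prob : Measure Ω) (Y : Set (Vec d'))
    (f : Vec d → Vec d' → ℝ) (G : Joint d d' → Ξ → Joint d d') (p : Params) (z₀ : Joint d d')
    (ξ : ℕ → ℕ → Ω → Ξ) (K : ℕ) (ε : ℝ) : Prop :=
  let gap : Ω → ℝ := fun ω =>
    let z := pes Y G p z₀ (fun k t => ξ k t ω) K
    dualityGap Y f (xPart z) (yPart z)
  Integrable gap prob ∧ ∫ ω, gap ω ∂prob ≤ ε

end PesAdaGrad

end

noncomputable section

namespace PesAdaGrad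

open Filter Topology

variable {d d' : ℕ}

/-! Let `D_j = P(x_j) - min P`. For the proximal objective `f + (μ/8)‖x - x_j‖²` let `R_j` be its
duality gap at the start `(x_j, y_j)` of an epoch and `Q_j` its gap at the output `(x_{j+1},
y_{j+1})`. Since `ρ ≤ μ/8`, this objective is strongly convex in `x` and strongly concave in `y`, so
an epoch solves a well-conditioned stochastic saddle point problem.

Three pathwise inequalities drive the proof. The AdaGrad regret bound gives `191 Q_j ≤ R_j + 192
N_j` with a noise term `N_j` (`IsProblem.epoch_bound`). Moving the proximal center to the new point
gives `R_{j+1} ≤ 10 Q_j + 8 (D_j - D_{j+1})` (`IsProblem.proxGap_recenter_le`). The PL inequality at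
the exact proximal point of `P` gives `D_{j+1} ≤ (3/5) D_j + 3 Q_j` (`IsProblem.primal_sub_le`).
Together they make `D_j + 5 Q_j` contract by a factor `0.82` up to noise
(`potential_le_noiseBound`). The PL inequality for `f(·, y)` finally turns `D_J + Q_J` into the true
duality gap at the price of a factor `7 (μ/μ_x + 1)` (`IsProblem.dualityGap_le`).

The gap compares with a saddle point that depends on the samples, so its inner product with the
accumulated gradient error need not have mean zero. Young's inequality splits this product into a
quadratic, absorbed by strong convexity and concavity, and the squared norm of a martingale. By
orthogonality of increments the mean of the latter is at most `E ∑ ‖g_t‖²`, which the AdaGrad norms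
control (`epochNoise_integrable_and_le`). The mean noise is proportional to `η_k²`, so it decays
like `e^{-k/16}`. This is slower than `0.82^k` and therefore sets the rate of the whole method.

For the iteration count, the epoch lengths grow geometrically, so the last one dominates the sum.
The choice of `η₀` balances the initial gap against the noise, and the logarithm comes only from
rounding each length up (`exists_params`). -/

/-! ### Existence of minimizers, strong concavity, proximal points. -/

theorem exists_forall_le_of_quadratic_lower_bound {E : Type*} [NormedAddCommGroup E]
    [ProperSpace E] {s : Set E} (hs : IsClosed s) {φ : E → ℝ} (hφ : ContinuousOn φ s) {z₀ : E}
    (hz₀ : z₀ ∈ s) {a b c : ℝ} (hc : 0 < c)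
    (h : ∀ z ∈ s, a - b * ‖z - z₀‖ + c * ‖z - z₀‖ ^ 2 ≤ φ z) :
    ∃ z ∈ s, ∀ w ∈ s, φ z ≤ φ w := by
  have hev : ∀ᶠ z in cocompact E ⊓ 𝓟 s, φ z₀ ≤ φ z := by
    have h1 := (tendsto_dist_right_cocompact_atTop z₀).eventually_ge_atTop
      (1 + (|φ z₀ - a| + |b|) / c)
    rw [eventually_inf_principal]
    filter_upwards [h1] with z hz hzs
    have h2 := h z hzs
    rw [dist_eq_norm] at hz
    set r := ‖z - z₀‖
    have h3 : c + (|φ z₀ - a| + |b|) ≤ c * r := by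
      calc c + (|φ z₀ - a| + |b|) = c * (1 + (|φ z₀ - a| + |b|) / c) := by field_simp
        _ ≤ c * r := by gcongr
    have h4 : 1 ≤ r := le_trans (by simp; positivity) hz
    have h5 := le_abs_self (φ z₀ - a)
    have h6 := le_abs_self b
    have h7 := abs_nonneg (φ z₀ - a)
    nlinarith [mul_le_mul_of_nonneg_right h3 (by linarith : 0 ≤ r),
      mul_le_mul_of_nonneg_left h4 h7, mul_le_mul_of_nonneg_right h6 (by linarith : 0 ≤ r)]
  obtain ⟨z, hz, hmin⟩ := hφ.exists_isMinOn' hs hz₀ hev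
  exact ⟨z, hz, fun w hw => hmin hw⟩

theorem le_of_forall_one_sub_mul_le {c e : ℝ} (h : ∀ s : ℝ, 0 < s → s < 1 → (1 - s) * c ≤ e) :
    c ≤ e := by
  have ht : Tendsto (fun s : ℝ => (1 - s) * c) (𝓝[>] 0) (𝓝 ((1 - 0) * c)) :=
    ((by fun_prop : Continuous fun s : ℝ => (1 - s) * c).tendsto 0).mono_left nhdsWithin_le_nhds
  have := le_of_tendsto ht (b := e) (by
    filter_upwards [Ioo_mem_nhdsGT (zero_lt_one' ℝ)] with s hs using h s hs.1 hs.2)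
  simpa using this

theorem strongConcaveOn_segment {E : Type*} [NormedAddCommGroup E] [NormedSpace ℝ E] {S : Set E}
    {φ : E → ℝ} {m : ℝ} (h : StrongConcaveOn S m φ) {y y' : E} (hy : y ∈ S) (hy' : y' ∈ S)
    {s : ℝ} (hs : 0 < s) (hs' : s < 1) :
    s * (φ y - φ y' + (1 - s) * (m / 2 * ‖y - y'‖ ^ 2)) ≤ φ (y' + s • (y - y')) - φ y' := by
  have := h.2 hy hy' hs.le (by linarith : 0 ≤ 1 - s) (by ring)
  have e : s • y + (1 - s) • y' = y' + s • (y - y') := by module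
  rw [e] at this
  simp only [smul_eq_mul] at this
  nlinarith

/-- Divide the segment inequality by `s` and let `s` tend to `0` from the right. Differentiability
is needed only at `y'`. -/
theorem strongConcaveOn_le_of_gradient {E : Type*} [NormedAddCommGroup E] [InnerProductSpace ℝ E]
    [CompleteSpace E] {S : Set E} {φ : E → ℝ} {m : ℝ} (h : StrongConcaveOn S m φ) {y y' : E}
    (hy : y ∈ S) (hy' : y' ∈ S) (hd : DifferentiableAt ℝ φ y') :
    φ y ≤ φ y' + inner ℝ (gradient φ y') (y - y') - m / 2 * ‖y - y'‖ ^ 2 := by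
  have h1 : HasDerivAt (fun s : ℝ => φ (y' + s • (y - y'))) (inner ℝ (gradient φ y') (y - y')) 0 := by
    have h2 : HasFDerivAt φ (InnerProductSpace.toDual ℝ E (gradient φ y')) (y' + (0 : ℝ) • (y - y')) := by
      simpa using hd.hasGradientAt.hasFDerivAt
    have h3 : HasDerivAt (fun s : ℝ => y' + s • (y - y')) (y - y') 0 := by
      simpa using ((hasDerivAt_id (0 : ℝ)).smul_const (y - y')).const_add y'
    exact h2.comp_hasDerivAt (0 : ℝ) h3
  have h2 := h1.tendsto_slope_zero_right
  have ht : Tendsto (fun s : ℝ => φ y - φ y' + (1 - s) * (m / 2 * ‖y - y'‖ ^ 2)) (𝓝[>] 0)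
      (𝓝 (φ y - φ y' + (1 - 0) * (m / 2 * ‖y - y'‖ ^ 2))) :=
    ((by fun_prop : Continuous fun s : ℝ =>
      φ y - φ y' + (1 - s) * (m / 2 * ‖y - y'‖ ^ 2)).tendsto 0).mono_left nhdsWithin_le_nhds
  have := le_of_tendsto_of_tendsto ht h2 (by
    filter_upwards [Ioo_mem_nhdsGT (zero_lt_one' ℝ)] with s hs
    have := strongConcaveOn_segment h hy hy' hs.1 hs.2
    have h0 := hs.1
    simp only [zero_add, zero_smul, add_zero, smul_eq_mul]
    rw [inv_mul_eq_div, le_div_iff₀ h0]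
    linarith)
  linarith

theorem strongConcaveOn_le_max {E : Type*} [NormedAddCommGroup E] [NormedSpace ℝ E] {S : Set E}
    {φ : E → ℝ} {m : ℝ} (h : StrongConcaveOn S m φ) {y y' : E} (hy : y ∈ S) (hy' : y' ∈ S)
    (hmax : ∀ w ∈ S, φ w ≤ φ y') : φ y + m / 2 * ‖y - y'‖ ^ 2 ≤ φ y' := by
  have := le_of_forall_one_sub_mul_le (c := m / 2 * ‖y - y'‖ ^ 2) (e := φ y' - φ y) (by
    intro s hs hs'
    have h1 := strongConcaveOn_segment h hy hy' hs hs'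
    have h2 : y' + s • (y - y') ∈ S := by
      have := h.1 hy hy' hs.le (by linarith : 0 ≤ 1 - s) (by ring)
      convert this using 1
      module
    have h3 := hmax _ h2
    have h4 : φ y - φ y' + (1 - s) * (m / 2 * ‖y - y'‖ ^ 2) ≤ 0 := by
      by_contra hcon
      push Not at hcon
      nlinarith [mul_pos hs hcon]
    linarith)
  linarith

/-- The proximal point `w` of a weakly convex function: a stationary point of the regularized
function, which grows quadratically away from it. -/
theorem exists_prox {n : ℕ} {φ : Vec n → ℝ} (hd : Differentiable ℝ φ) {c : ℝ} (hc : ∀ x, c ≤ φ x)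
    {ρ γ : ℝ} (hγ : 0 < γ)
    (hw : ∀ x x', inner ℝ (gradient φ x') (x - x') - ρ / 2 * ‖x - x'‖ ^ 2 ≤ φ x - φ x')
    (p : Vec n) :
    ∃ w, gradient φ w = γ • (p - w) ∧
      ∀ x, φ w + γ / 2 * ‖w - p‖ ^ 2 + (γ - ρ) / 2 * ‖x - w‖ ^ 2 ≤ φ x + γ / 2 * ‖x - p‖ ^ 2 := by
  obtain ⟨w, -, hmin⟩ := exists_forall_le_of_quadratic_lower_bound (E := Vec n) isClosed_univ
    (φ := fun x => φ x + γ / 2 * ‖x - p‖ ^ 2)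
    ((hd.continuous.add (by fun_prop)).continuousOn) (Set.mem_univ p) (a := c) (b := 0)
    (c := γ / 2) (by positivity) (fun z _ => by simpa using hc z)
  have hg : gradient φ w = γ • (p - w) := by
    have h1 : HasFDerivAt (fun x => φ x + γ / 2 * ‖x - p‖ ^ 2)
        (InnerProductSpace.toDual ℝ (Vec n) (gradient φ w)
          + (γ / 2) • ((2 : ℕ) • innerSL ℝ (w - p))) w := by
      have h2 : HasFDerivAt (fun x : Vec n => ‖x - p‖ ^ 2) ((2 : ℕ) • innerSL ℝ (w - p)) w := by
        have := ((hasFDerivAt_id (𝕜 := ℝ) w).sub_const p).norm_sq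
        simpa using this
      exact (hd w).hasGradientAt.hasFDerivAt.add (h2.const_mul (γ / 2))
    have h0 := IsLocalMin.hasFDerivAt_eq_zero
      (Eventually.of_forall fun x => hmin x (Set.mem_univ x)) h1
    have h3 := DFunLike.congr_fun h0 (gradient φ w - γ • (p - w))
    simp only [add_apply, InnerProductSpace.toDual_apply_apply,
      smul_apply, innerSL_apply_apply, zero_apply,
      nsmul_eq_mul, smul_eq_mul, Nat.cast_ofNat] at h3
    have h4 : inner ℝ (gradient φ w - γ • (p - w)) (gradient φ w - γ • (p - w)) = 0 := by
      rw [← h3]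
      conv_lhs => rw [inner_sub_left, inner_smul_left]
      rw [← neg_sub w p, inner_neg_left]
      simp
      ring
    exact sub_eq_zero.1 (inner_self_eq_zero.1 h4)
  refine ⟨w, hg, fun x => ?_⟩
  have h1 := hw x w
  rw [hg, inner_smul_left] at h1
  have h2 : ‖x - p‖ ^ 2 = ‖x - w‖ ^ 2 + 2 * inner ℝ (x - w) (w - p) + ‖w - p‖ ^ 2 := by
    rw [← norm_add_sq_real]
    congr 2
    abel
  have h3 : inner ℝ (p - w) (x - w) = - inner ℝ (x - w) (w - p) := by
    rw [real_inner_comm, ← inner_neg_right, neg_sub]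
  rw [h3] at h1
  simp at h1
  rw [h2]
  nlinarith

/-! ### Deterministic inequalities for the proximal gap. -/

section Problem

variable {Y : Set (Vec d')} {f : Vec d → Vec d' → ℝ} {ℓ L ρ μ μx μy : ℝ}

/-- The minimal value over `x` of the proximal objective `f(x, y) + (μ/8) ‖x - q‖²`. -/
def proxValue (f : Vec d → Vec d' → ℝ) (μ : ℝ) (q : Vec d) (y : Vec d') : ℝ :=
  sInf (Set.range (fun x => f x y + μ / 8 * ‖x - q‖ ^ 2))

/-- The duality gap of the proximal objective `f(x, y) + (μ/8) ‖x - q‖²`. -/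
def proxGap (Y : Set (Vec d')) (f : Vec d → Vec d' → ℝ) (μ : ℝ) (q x : Vec d) (y : Vec d') : ℝ :=
  primal Y f x + μ / 8 * ‖x - q‖ ^ 2 - proxValue f μ q y

theorem IsProblem.exists_max (h : IsProblem Y f ℓ L ρ μ μx μy) (hμy : 0 < μy) (hY : Y.Nonempty)
    (x : Vec d) :
    ∃ v ∈ Y, primal Y f x = f x v ∧ ∀ y ∈ Y, f x y + μy / 2 * ‖y - v‖ ^ 2 ≤ primal Y f x := by
  obtain ⟨y₀, hy₀⟩ := hY
  obtain ⟨v, hv, hmax⟩ := exists_forall_le_of_quadratic_lower_bound (E := Vec d') h.closed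
    (φ := fun y => - f x y)
    (fun y hy => (h.diff_y x y hy).continuousAt.continuousWithinAt.neg) hy₀
    (a := - f x y₀) (b := ‖gradY f x y₀‖) (c := μy / 2) (by positivity) (fun z hz => by
      have h1 := strongConcaveOn_le_of_gradient (h.strongConcave x) hz hy₀ (h.diff_y x y₀ hy₀)
      have h2 := real_inner_le_norm (gradient (fun y => f x y) y₀) (z - y₀)
      change _ - ‖gradient (fun y => f x y) y₀‖ * _ + _ ≤ _
      linarith)
  have hmax' : ∀ w ∈ Y, f x w ≤ f x v := fun w hw => by linarith [hmax w hw]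
  have hP : primal Y f x = f x v := by
    refine IsGreatest.csSup_eq ⟨⟨v, hv, rfl⟩, ?_⟩
    rintro _ ⟨w, hw, rfl⟩
    exact hmax' w hw
  refine ⟨v, hv, hP, fun y hy => ?_⟩
  rw [hP]
  exact strongConcaveOn_le_max (h.strongConcave x) hy hv hmax'

theorem IsProblem.le_primal (h : IsProblem Y f ℓ L ρ μ μx μy) (hμy : 0 < μy) (x : Vec d)
    {y : Vec d'} (hy : y ∈ Y) : f x y ≤ primal Y f x := by
  obtain ⟨v, -, -, hv⟩ := h.exists_max hμy ⟨y, hy⟩ x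
  have := hv y hy
  have h2 : 0 ≤ μy / 2 * ‖y - v‖ ^ 2 := by positivity
  linarith

/-- Danskin's argument: if `v` maximizes `f x' ·`, then `P - f(·, v)` is nonnegative and vanishes at
`x'`, so the two gradients agree there and weak convexity passes from `f(·, v)` to `P`. -/
theorem IsProblem.primal_weakConvex (h : IsProblem Y f ℓ L ρ μ μx μy) (hμy : 0 < μy)
    (hY : Y.Nonempty) (x x' : Vec d) :
    inner ℝ (gradient (primal Y f) x') (x - x') - ρ / 2 * ‖x - x'‖ ^ 2
      ≤ primal Y f x - primal Y f x' := by
  obtain ⟨v, hv, hP, -⟩ := h.exists_max hμy hY x'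
  have hg : gradient (primal Y f) x' = gradX f x' v := by
    have h0 : IsLocalMin (fun z => primal Y f z - f z v) x' :=
      Eventually.of_forall fun z => by
        have := h.le_primal hμy z hv
        change primal Y f x' - f x' v ≤ primal Y f z - f z v
        linarith
    have h1 := h0.hasFDerivAt_eq_zero
      ((h.primal_diff x').hasFDerivAt.sub (h.diff_x x' v hv).hasFDerivAt)
    unfold gradX gradient
    rw [sub_eq_zero.1 h1]
  have h1 := h.weakConvex v hv x x'
  have h2 := h.le_primal hμy x hv
  rw [hg, hP]
  linarith

/-- The growth constant is `(γ - ρ)/2 ≥ μ/16`, because `γ = μ/4` and `ρ ≤ μ/8`. -/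
theorem IsProblem.exists_proxMin (h : IsProblem Y f ℓ L ρ μ μx μy) (hμ : 0 < μ) (hρ : ρ ≤ μ / 8)
    (q : Vec d) {y : Vec d'} (hy : y ∈ Y) :
    ∃ w, gradX f w y = (μ / 4) • (q - w) ∧ proxValue f μ q y = f w y + μ / 8 * ‖w - q‖ ^ 2 ∧
      ∀ x, proxValue f μ q y + μ / 16 * ‖x - w‖ ^ 2 ≤ f x y + μ / 8 * ‖x - q‖ ^ 2 := by
  obtain ⟨xs, hxs, -⟩ := h.xside_PL y hy
  obtain ⟨w, hw, hgrow⟩ := exists_prox (φ := fun x => f x y) (fun x => h.diff_x x y hy) hxs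
    (γ := μ / 4) (by positivity) (h.weakConvex y hy) q
  have hgrow' : ∀ x, f w y + μ / 8 * ‖w - q‖ ^ 2 + μ / 16 * ‖x - w‖ ^ 2
      ≤ f x y + μ / 8 * ‖x - q‖ ^ 2 := fun x => by
    have := hgrow x
    nlinarith [sq_nonneg ‖x - w‖]
  have hv : proxValue f μ q y = f w y + μ / 8 * ‖w - q‖ ^ 2 := by
    refine IsLeast.csInf_eq ⟨⟨w, rfl⟩, ?_⟩
    rintro _ ⟨x, rfl⟩
    have := hgrow' x
    have h2 : 0 ≤ μ / 16 * ‖x - w‖ ^ 2 := by positivity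
    simp only
    linarith
  exact ⟨w, hw, hv, fun x => by rw [hv]; exact hgrow' x⟩

theorem IsProblem.proxValue_le (h : IsProblem Y f ℓ L ρ μ μx μy) (hμ : 0 < μ) (hρ : ρ ≤ μ / 8)
    (q : Vec d) {y : Vec d'} (hy : y ∈ Y) (x : Vec d) :
    proxValue f μ q y ≤ f x y + μ / 8 * ‖x - q‖ ^ 2 := by
  obtain ⟨w, -, -, hw⟩ := h.exists_proxMin hμ hρ q hy
  have := hw x
  have h2 : 0 ≤ μ / 16 * ‖x - w‖ ^ 2 := by positivity
  linarith

theorem norm_sq_sub_le {n : ℕ} (a b c : Vec n) :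
    ‖a - c‖ ^ 2 ≤ 2 * ‖a - b‖ ^ 2 + 2 * ‖b - c‖ ^ 2 := by
  have h1 : ‖a - c‖ ≤ ‖a - b‖ + ‖b - c‖ := norm_sub_le_norm_sub_add_norm_sub a b c
  nlinarith [norm_nonneg (a - c), sq_nonneg (‖a - b‖ - ‖b - c‖)]

section
variable (h : IsProblem Y f ℓ L ρ μ μx μy) (hμ : 0 < μ) (hμy : 0 < μy) (hρ : ρ ≤ μ / 8)
  (q x : Vec d) {y : Vec d'} (hy : y ∈ Y)
include h hμ hμy hρ hy

theorem IsProblem.dist_le_proxGap :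
    μ / 8 * ‖x - q‖ ^ 2 ≤ primal Y f q - primal Y f x + proxGap Y f μ q x y := by
  have h1 := h.proxValue_le hμ hρ q hy q
  have h2 := h.le_primal hμy q hy
  simp only [sub_self, norm_zero] at h1
  unfold proxGap
  linarith

theorem IsProblem.proxGap_nonneg : 0 ≤ proxGap Y f μ q x y := by
  have h1 := h.proxValue_le hμ hρ q hy x
  have h2 := h.le_primal hμy x hy
  unfold proxGap
  linarith

/-- With `R` the left side and `w` the proximal point of `f(·, y)` at `x`, comparing both centers at
`w` gives `R ≤ proxGap q + (μ/4)⟨w - x, x - q⟩`. Young's inequality leaves `(μ/32)‖w - x‖² ≤ R/2`,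
which is absorbed, and `(μ/2)‖x - q‖²`, which `IsProblem.dist_le_proxGap` bounds. -/
theorem IsProblem.proxGap_recenter_le :
    proxGap Y f μ x x y ≤
      10 * proxGap Y f μ q x y + 8 * (primal Y f q - primal Y f x) := by
  have h4 := h.dist_le_proxGap hμ hμy hρ q x hy
  obtain ⟨w, -, hv, hw⟩ := h.exists_proxMin hμ hρ x hy
  have h1 := hw x
  have h2 := h.le_primal hμy x hy
  have h3 := h.proxValue_le hμ hρ q hy w
  have h5 : ‖w - q‖ ^ 2 = ‖w - x‖ ^ 2 + 2 * inner ℝ (w - x) (x - q) + ‖x - q‖ ^ 2 := by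
    rw [← norm_add_sq_real]
    congr 2
    abel
  have h6 : inner ℝ (w - x) (x - q) ≤ 1 / 8 * ‖w - x‖ ^ 2 + 2 * ‖x - q‖ ^ 2 := by
    have := real_inner_le_norm (w - x) (x - q)
    nlinarith [sq_nonneg (1 / 4 * ‖w - x‖ - ‖x - q‖)]
  have h7 := mul_le_mul_of_nonneg_left h6 (by positivity : 0 ≤ μ / 4)
  rw [norm_sub_rev x w, sub_self, norm_zero] at h1
  unfold proxGap at h4 ⊢
  rw [sub_self, norm_zero]
  rw [hv] at h1 ⊢
  rw [h5] at h3
  linarith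

/-- The exact proximal point `w` of `P` at `q` has `∇P(w) = (μ/4)(q - w)`, so the PL inequality
makes `P(w) - c` at most `(μ/32)‖w - q‖²`, while the proximal step has already decreased `P` by a
multiple of `‖w - q‖²`. The proximal gap measures how far `x` falls short of `w`. -/
theorem IsProblem.primal_sub_le {c : ℝ} (hc : ∀ x, c ≤ primal Y f x)
    (hPL : ∀ x, 2 * μ * (primal Y f x - c) ≤ ‖gradient (primal Y f) x‖ ^ 2) :
    primal Y f x - c ≤ 3 / 5 * (primal Y f q - c) + 3 * proxGap Y f μ q x y := by
  obtain ⟨w, hg, hw⟩ := exists_prox h.primal_diff hc (γ := μ / 4) (by positivity)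
    (h.primal_weakConvex hμy ⟨y, hy⟩) q
  have h1 := hPL w
  rw [hg, norm_smul, Real.norm_of_nonneg (by positivity), norm_sub_rev] at h1
  have h1' : primal Y f w - c ≤ μ / 32 * ‖w - q‖ ^ 2 := by
    have : 2 * μ * (primal Y f w - c) ≤ 2 * μ * (μ / 32 * ‖w - q‖ ^ 2) := by
      linarith
    exact le_of_mul_le_mul_left this (by positivity)
  have h2 := hw q
  have h3 := hw x
  rw [sub_self, norm_zero] at h2
  have h4 := h.proxValue_le hμ hρ q hy w
  have h5 := h.le_primal hμy w hy
  have h6 := norm_sq_sub_le w x q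
  rw [norm_sub_rev w x] at h6
  have h7 := mul_le_mul_of_nonneg_right hρ (sq_nonneg ‖x - w‖)
  have h8 := mul_le_mul_of_nonneg_right hρ (sq_nonneg ‖q - w‖)
  have h9 : 0 ≤ μ * ‖q - w‖ ^ 2 := by positivity
  have h10 := mul_le_mul_of_nonneg_left h6 hμ.le
  unfold proxGap
  linarith

/-- The true minimum over `x` lies below the proximal one; at the proximal point `w` the gradient is
`(μ/4)(q - w)`, so the `μx`-PL inequality bounds the difference by a multiple of `‖w - q‖²`. -/
theorem IsProblem.dualityGap_le (hμx : 0 < μx) {c : ℝ} (hc : ∀ x, c ≤ primal Y f x) :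
    dualityGap Y f x y ≤
      7 * (μ / μx + 1) * (primal Y f q - c + proxGap Y f μ q x y) := by
  obtain ⟨w, hg, hv, hw⟩ := h.exists_proxMin hμ hρ q hy
  obtain ⟨xs, hxs, hPL⟩ := h.xside_PL y hy
  have hinf : sInf (Set.range (fun x' => f x' y)) = f xs y := by
    refine IsLeast.csInf_eq ⟨⟨xs, rfl⟩, ?_⟩
    rintro _ ⟨x, rfl⟩
    exact hxs x
  have h1 : 2 * μx * (f w y - f xs y) ≤ ‖gradX f w y‖ ^ 2 := hPL w
  rw [hg, norm_smul, Real.norm_of_nonneg (by positivity), norm_sub_rev] at h1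
  have h1' : f w y - f xs y ≤ μ / μx * (μ / 32 * ‖w - q‖ ^ 2) := by
    rw [div_mul_eq_mul_div, le_div_iff₀ hμx]
    linarith
  have h2 := h.dist_le_proxGap hμ hμy hρ q x hy
  have h3 := hw x
  have h4 := h.le_primal hμy x hy
  have h5 := norm_sq_sub_le w x q
  rw [norm_sub_rev w x] at h5
  have h6 := hc x
  have h7 := mul_le_mul_of_nonneg_left h5 hμ.le
  have hB : 0 ≤ μ / μx := by positivity
  have hS : μ / 8 * ‖w - q‖ ^ 2 ≤ 6 * proxGap Y f μ q x y + 2 * (primal Y f q - c) := by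
    unfold proxGap at h2 ⊢
    linarith
  have h0 := h.proxGap_nonneg hμ hμy hρ q x hy
  have hD : 0 ≤ primal Y f q - c := by linarith [hc q]
  have hm := mul_le_mul_of_nonneg_left hS hB
  have h9 : 0 ≤ μ / μx * proxGap Y f μ q x y := by positivity
  have h10 : 0 ≤ μ / μx * (primal Y f q - c) := by positivity
  have h11 : 0 ≤ μ / μx * (μ / 32 * ‖w - q‖ ^ 2) := by positivity
  have hgap : dualityGap Y f x y ≤ proxGap Y f μ q x y + μ / 8 * ‖w - q‖ ^ 2
      + μ / μx * (μ / 32 * ‖w - q‖ ^ 2) := by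
    unfold dualityGap proxGap
    rw [hinf, hv]
    have : 0 ≤ μ * ‖x - q‖ ^ 2 := by positivity
    linarith
  nlinarith

/-- Take for `x'` the proximal minimizer at `y` and for `y'` the maximizer at `x`. Quadratic growth
bounds their squared distances from the center by `2 / min (μ/8) μy` times the sum of the new and
the old gap. Hence the quadratic term is at most `1/192` of that sum, and the new gap moves to the
left. -/
theorem IsProblem.proxGap_le_of_forall {yq : Vec d'} (hyq : yq ∈ Y) {N : ℝ}
    (hN : ∀ x', ∀ y' ∈ Y, f x y' + μ / 8 * ‖x - q‖ ^ 2 - (f x' y + μ / 8 * ‖x' - q‖ ^ 2) ≤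
      min (μ / 8) μy / 384 * (‖x' - q‖ ^ 2 + ‖y' - yq‖ ^ 2) + N) :
    191 * proxGap Y f μ q x y ≤ proxGap Y f μ q q yq + 192 * N := by
  obtain ⟨w, -, hv, hw⟩ := h.exists_proxMin hμ hρ q hy
  obtain ⟨v, hvY, hP, hvmax⟩ := h.exists_max hμy ⟨y, hy⟩ x
  have h1 := hN w v hvY
  have h2 := hw q
  have h3 := hvmax yq hyq
  have h4 := h.proxValue_le hμ hρ q hyq x
  have h5 := h.le_primal hμy q hy
  rw [sub_self, norm_zero, norm_sub_rev] at h2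
  rw [norm_sub_rev] at h3
  have h6 := mul_le_mul_of_nonneg_right (min_le_left (μ / 8) μy) (sq_nonneg ‖w - q‖)
  have h7 := mul_le_mul_of_nonneg_right (min_le_right (μ / 8) μy) (sq_nonneg ‖v - yq‖)
  unfold proxGap
  rw [sub_self, norm_zero]
  rw [hP] at *
  linarith

end

theorem IsProblem.proxGap_self_le (h : IsProblem Y f ℓ L ρ μ μx μy) (hμ : 0 < μ)
    (hρ : ρ ≤ μ / 8) (x : Vec d) {y : Vec d'} (hy : y ∈ Y) :
    proxGap Y f μ x x y ≤ dualityGap Y f x y := by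
  obtain ⟨w, -, hv, -⟩ := h.exists_proxMin hμ hρ x hy
  obtain ⟨xs, hxs, -⟩ := h.xside_PL y hy
  have h1 : sInf (Set.range (fun x' => f x' y)) ≤ f w y :=
    csInf_le ⟨f xs y, by rintro _ ⟨x, rfl⟩; exact hxs x⟩ ⟨w, rfl⟩
  have h2 : 0 ≤ μ / 8 * ‖w - x‖ ^ 2 := by positivity
  unfold proxGap dualityGap
  rw [sub_self, norm_zero, hv]
  linarith

theorem IsProblem.primal_sub_le_dualityGap (h : IsProblem Y f ℓ L ρ μ μx μy)
    (hμy : 0 < μy) (x xs : Vec d) {y : Vec d'} (hy : y ∈ Y) :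
    primal Y f x - primal Y f xs ≤ dualityGap Y f x y := by
  obtain ⟨x₁, hx₁, -⟩ := h.xside_PL y hy
  have h1 : sInf (Set.range (fun x' => f x' y)) ≤ f xs y :=
    csInf_le ⟨f x₁ y, by rintro _ ⟨x, rfl⟩; exact hx₁ x⟩ ⟨xs, rfl⟩
  have h2 := h.le_primal hμy xs hy
  unfold dualityGap
  linarith

end Problem

/-! ### The AdaGrad step: existence, continuity, regret. -/

theorem joint_norm_sq (z : Joint d d') : ‖z‖ ^ 2 = ∑ i, z i ^ 2 := by
  simp [EuclideanSpace.norm_sq_eq]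

theorem joint_inner (z w : Joint d d') : inner ℝ z w = ∑ i, z i * w i := by
  simp [PiLp.inner_apply, mul_comm]

/-- The objective of an AdaGrad step, `η ⟨z - z₀, S⟩ + ½ ∑ᵢ (δ + √bᵢ) (zᵢ - z₀ᵢ)²`. -/
def adaObj (δ η : ℝ) (z₀ S : Joint d d') (b : Fin d ⊕ Fin d' → ℝ) (z : Joint d d') : ℝ :=
  η * inner ℝ (z - z₀) S + 1 / 2 * ∑ i, (δ + √(b i)) * (z i - z₀ i) ^ 2

/-- The AdaGrad step as a function of the center, the sum of the gradients and the weights. -/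
def adaStep (Z : Set (Joint d d')) (δ η t : ℝ) (z₀ S : Joint d d') (b : Fin d ⊕ Fin d' → ℝ) :
    Joint d d' :=
  argminOn Z (fun z => η * inner ℝ z ((1 / t) • S)
    + 1 / t * (1 / 2 * ∑ i, (δ + √(b i)) * (z i - z₀ i) ^ 2))

theorem delta_mul_norm_sq_le {δ : ℝ} (b : Fin d ⊕ Fin d' → ℝ) (z : Joint d d') :
    δ * ‖z‖ ^ 2 ≤ ∑ i, (δ + √(b i)) * z i ^ 2 := by
  rw [joint_norm_sq, Finset.mul_sum]
  gcongr with i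
  exact le_add_of_nonneg_right (Real.sqrt_nonneg _)

theorem adaObj_sub (δ η : ℝ) (z₀ S : Joint d d') (b : Fin d ⊕ Fin d' → ℝ) (z w : Joint d d') :
    adaObj δ η z₀ S b w - adaObj δ η z₀ S b z =
      (∑ i, (w i - z i) * (η * S i + (δ + √(b i)) * (z i - z₀ i)))
        + 1 / 2 * ∑ i, (δ + √(b i)) * (w i - z i) ^ 2 := by
  simp only [adaObj, joint_inner, Finset.mul_sum, ← Finset.sum_sub_distrib,
    ← Finset.sum_add_distrib]
  refine Finset.sum_congr rfl fun i _ => ?_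
  simp only [PiLp.sub_apply]
  ring

theorem adaObj_growth {Z : Set (Joint d d')} (hZ : Convex ℝ Z) {δ η : ℝ} {z₀ S : Joint d d'}
    {b : Fin d ⊕ Fin d' → ℝ} {z w : Joint d d'} (hz : z ∈ Z) (hw : w ∈ Z)
    (hmin : ∀ w ∈ Z, adaObj δ η z₀ S b z ≤ adaObj δ η z₀ S b w) :
    adaObj δ η z₀ S b z + 1 / 2 * ∑ i, (δ + √(b i)) * (w i - z i) ^ 2 ≤ adaObj δ η z₀ S b w := by
  have := le_of_forall_one_sub_mul_le (c := 1 / 2 * ∑ i, (δ + √(b i)) * (w i - z i) ^ 2)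
    (e := adaObj δ η z₀ S b w - adaObj δ η z₀ S b z) (by
    intro s hs hs'
    have h2 : z + s • (w - z) ∈ Z := by
      have := hZ hw hz hs.le (by linarith : 0 ≤ 1 - s) (by ring)
      convert this using 1
      module
    have h3 := sub_nonneg.2 (hmin _ h2)
    rw [adaObj_sub] at h3 ⊢
    set A := ∑ i, (w i - z i) * (η * S i + (δ + √(b i)) * (z i - z₀ i)) with hA
    set B := ∑ i, (δ + √(b i)) * (w i - z i) ^ 2 with hB
    have hA' : ∑ i, ((z + s • (w - z)) i - z i) * (η * S i + (δ + √(b i)) * (z i - z₀ i)) = s * A := by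
      rw [hA, Finset.mul_sum]
      refine Finset.sum_congr rfl fun i _ => ?_
      simp
      ring
    have hB' : ∑ i, (δ + √(b i)) * ((z + s • (w - z)) i - z i) ^ 2 = s ^ 2 * B := by
      rw [hB, Finset.mul_sum]
      refine Finset.sum_congr rfl fun i _ => ?_
      simp
      ring
    rw [hA', hB'] at h3
    have h4 : 0 ≤ A + 1 / 2 * (s * B) := by
      by_contra hcon
      push Not at hcon
      nlinarith [mul_pos hs (neg_pos.2 hcon)]
    linarith)
  linarith

/-- The objective of the algorithm is `1/t` times `adaObj` plus a constant, so both have the same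
minimizers. -/
theorem adaStep_mem_and_growth {Z : Set (Joint d d')} (hc : IsClosed Z) (hZ : Convex ℝ Z)
    (hne : Z.Nonempty) {δ η t : ℝ} (hδ : 0 < δ) (ht : 0 < t) (z₀ S : Joint d d')
    (b : Fin d ⊕ Fin d' → ℝ) :
    adaStep Z δ η t z₀ S b ∈ Z ∧ ∀ w ∈ Z,
      adaObj δ η z₀ S b (adaStep Z δ η t z₀ S b)
        + 1 / 2 * ∑ i, (δ + √(b i)) * (w i - adaStep Z δ η t z₀ S b i) ^ 2
        ≤ adaObj δ η z₀ S b w := by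
  have hobj : ∀ z : Joint d d', η * inner ℝ z ((1 / t) • S)
      + 1 / t * (1 / 2 * ∑ i, (δ + √(b i)) * (z i - z₀ i) ^ 2)
      = 1 / t * (adaObj δ η z₀ S b z + η * inner ℝ z₀ S) := fun z => by
    rw [adaObj, inner_smul_right, inner_sub_left]
    ring
  have hex : ∃ z, z ∈ Z ∧ ∀ w ∈ Z, adaObj δ η z₀ S b z ≤ adaObj δ η z₀ S b w := by
    obtain ⟨z₁, hz₁⟩ := hne
    refine exists_forall_le_of_quadratic_lower_bound hc
      (by unfold adaObj; fun_prop) hz₁ (a := adaObj δ η z₀ S b z₁)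
      (b := ‖(WithLp.toLp 2 (fun i => η * S i + (δ + √(b i)) * (z₁ i - z₀ i)) : Joint d d')‖)
      (c := δ / 2) (by positivity) (fun z _ => ?_)
    have h1 := adaObj_sub δ η z₀ S b z₁ z
    have h2 := delta_mul_norm_sq_le (δ := δ) b (z - z₁)
    have h3 := abs_real_inner_le_norm (z - z₁)
      (WithLp.toLp 2 (fun i => η * S i + (δ + √(b i)) * (z₁ i - z₀ i)) : Joint d d')
    rw [abs_le, joint_inner] at h3
    simp only [PiLp.sub_apply] at h2 h3
    linarith [h3.1]
  have hspec := Classical.epsilon_spec (p := fun z => z ∈ Z ∧ ∀ w ∈ Z,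
      (η * inner ℝ z ((1 / t) • S) + 1 / t * (1 / 2 * ∑ i, (δ + √(b i)) * (z i - z₀ i) ^ 2)) ≤
      (η * inner ℝ w ((1 / t) • S) + 1 / t * (1 / 2 * ∑ i, (δ + √(b i)) * (w i - z₀ i) ^ 2))) (by
    obtain ⟨z, hz, hmin⟩ := hex
    refine ⟨z, hz, fun w hw => ?_⟩
    rw [hobj, hobj]
    have := hmin w hw
    gcongr)
  change adaStep Z δ η t z₀ S b ∈ Z ∧ _ at hspec
  refine ⟨hspec.1, fun w hw => adaObj_growth hZ hspec.1 hw fun w hw => ?_⟩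
  have := hspec.2 w hw
  rw [hobj, hobj] at this
  have := le_of_mul_le_mul_left this (by positivity)
  change adaObj δ η z₀ S b (adaStep Z δ η t z₀ S b) + _ ≤ _ at this
  linarith

/-- This yields measurability of the iterates, although the step is defined by a choice. Adding the
growth inequalities for two parameter values gives `δ‖z' - z‖² ≤ ‖z' - z‖‖D‖`, where `D` is the
difference of the two objective gradients at the fixed minimizer `z`. -/
theorem continuous_adaStep {Z : Set (Joint d d')} (hc : IsClosed Z) (hZ : Convex ℝ Z)
    (hne : Z.Nonempty) {δ η t : ℝ} (hδ : 0 < δ) (ht : 0 < t) :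
    Continuous (fun p : Joint d d' × Joint d d' × (Fin d ⊕ Fin d' → ℝ) =>
      adaStep Z δ η t p.1 p.2.1 p.2.2) := by
  rw [continuous_iff_continuousAt]
  rintro p
  obtain ⟨hz, hgz⟩ := adaStep_mem_and_growth hc hZ hne (η := η) hδ ht p.1 p.2.1 p.2.2
  unfold ContinuousAt
  set z := adaStep Z δ η t p.1 p.2.1 p.2.2
  rw [tendsto_iff_norm_sub_tendsto_zero]
  let D : Joint d d' × Joint d d' × (Fin d ⊕ Fin d' → ℝ) → Joint d d' := fun p' =>
    WithLp.toLp 2 (fun i => (η * p.2.1 i + (δ + √(p.2.2 i)) * (z i - p.1 i))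
      - (η * p'.2.1 i + (δ + √(p'.2.2 i)) * (z i - p'.1 i)))
  have hD : Continuous fun p' => ‖D p'‖ / δ := by
    simp only [D]
    fun_prop
  have hD0 : ‖D p‖ / δ = 0 := by
    have : D p = 0 := by
      ext i
      simp [D]
    simp [this]
  have hlim := hD.tendsto p
  rw [hD0] at hlim
  refine squeeze_zero (fun _ => norm_nonneg _) (fun p' => ?_) hlim
  obtain ⟨hz', hgz'⟩ := adaStep_mem_and_growth hc hZ hne (η := η) hδ ht p'.1 p'.2.1 p'.2.2
  set z' := adaStep Z δ η t p'.1 p'.2.1 p'.2.2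
  have h1 := hgz _ hz'
  have h2 := hgz' _ hz
  have h3 := adaObj_sub δ η p.1 p.2.1 p.2.2 z z'
  have h4 := adaObj_sub δ η p'.1 p'.2.1 p'.2.2 z z'
  have h5 := delta_mul_norm_sq_le (δ := δ) p'.2.2 (z' - z)
  have h6 := real_inner_le_norm (z' - z) (D p')
  rw [joint_inner] at h6
  have h7 : ∑ i, (z' - z) i * D p' i =
      (∑ i, (z' i - z i) * (η * p.2.1 i + (δ + √(p.2.2 i)) * (z i - p.1 i)))
      - ∑ i, (z' i - z i) * (η * p'.2.1 i + (δ + √(p'.2.2 i)) * (z i - p'.1 i)) := by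
    rw [← Finset.sum_sub_distrib]
    refine Finset.sum_congr rfl fun i _ => ?_
    simp only [D, PiLp.sub_apply]
    ring
  have h8 : ∑ i, (δ + √(p'.2.2 i)) * (z i - z' i) ^ 2 = ∑ i, (δ + √(p'.2.2 i)) * (z' i - z i) ^ 2 :=
    Finset.sum_congr rfl fun i _ => by ring
  simp only [PiLp.sub_apply] at h5
  rw [h8] at h2
  have h9 : δ * ‖z' - z‖ ^ 2 ≤ ‖z' - z‖ * ‖D p'‖ := by linarith
  rw [le_div_iff₀ hδ]
  rcases eq_or_lt_of_le (norm_nonneg (z' - z)) with h | h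
  · rw [← h]; simp
  · nlinarith

/-- Makes the AdaGrad terms telescope. The denominator `δ + √b` omits the newest gradient; the bound
`|x| ≤ δ` lets `δ` stand in for it. -/
theorem sq_div_le_sqrt_sub {δ b x : ℝ} (hb : 0 ≤ b) (hx : |x| ≤ δ) :
    x ^ 2 ≤ 2 * (δ + √b) * (√(b + x ^ 2) - √b) := by
  set s := √b
  set s' := √(b + x ^ 2)
  have h1 : s ^ 2 = b := Real.sq_sqrt hb
  have h2 : s' ^ 2 = b + x ^ 2 := Real.sq_sqrt (by positivity)
  have hs : 0 ≤ s := Real.sqrt_nonneg _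
  have hss : s ≤ s' := Real.sqrt_le_sqrt (by nlinarith)
  have h3 : x ^ 2 ≤ δ ^ 2 := sq_le_sq' (by linarith [(abs_le.1 hx).1]) (abs_le.1 hx).2
  have h4 : s' ≤ δ + s := by
    refine abs_le_of_sq_le_sq' ?_ (by linarith [abs_nonneg x]) |>.2
    nlinarith [mul_nonneg ((abs_nonneg x).trans hx) hs]
  have h5 : x ^ 2 = (s' - s) * (s' + s) := by nlinarith
  rw [h5]
  nlinarith [mul_nonneg (sub_nonneg.2 hss) (by linarith : 0 ≤ 2 * (δ + s) - (s' + s))]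

section State

variable {Z : Set (Joint d d')} (hc : IsClosed Z) (hZ : Convex ℝ Z) {δ η : ℝ} (hδ : 0 < δ)
  (g : ℕ → Joint d d' → Joint d d') {z₀ : Joint d d'} (hz₀ : z₀ ∈ Z)
include hc hZ hδ hz₀

theorem adaState_mem_and_growth (n : ℕ) :
    (adaState Z g δ η z₀ n).z ∈ Z ∧ ∀ w ∈ Z,
      adaObj δ η z₀ (adaState Z g δ η z₀ n).gsum (adaState Z g δ η z₀ n).gsq
          (adaState Z g δ η z₀ n).z
        + 1 / 2 * ∑ i, (δ + √((adaState Z g δ η z₀ n).gsq i))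
            * (w i - (adaState Z g δ η z₀ n).z i) ^ 2
        ≤ adaObj δ η z₀ (adaState Z g δ η z₀ n).gsum (adaState Z g δ η z₀ n).gsq w := by
  cases n with
  | zero => exact ⟨hz₀, fun w _ => by simp [adaObj, adaState]⟩
  | succ n =>
    exact adaStep_mem_and_growth hc hZ ⟨z₀, hz₀⟩ (η := η) hδ (t := (n : ℝ) + 1) (by positivity) z₀
      (adaState Z g δ η z₀ (n + 1)).gsum (adaState Z g δ η z₀ (n + 1)).gsq

/-- Bounded gradients keep the iterates at bounded distance from the center, which makes all later
expectations finite. -/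
theorem adaState_dist_le (hη : 0 < η) (n : ℕ) :
    δ * ‖(adaState Z g δ η z₀ n).z - z₀‖ ≤ η * ‖(adaState Z g δ η z₀ n).gsum‖ := by
  obtain ⟨-, h1⟩ := adaState_mem_and_growth hc hZ (η := η) hδ g hz₀ n
  have h1 := h1 z₀ hz₀
  set s := adaState Z g δ η z₀ n
  have h2 : ∑ i, (δ + √(s.gsq i)) * (z₀ i - s.z i) ^ 2 = ∑ i, (δ + √(s.gsq i)) * (s.z i - z₀ i) ^ 2 :=
    Finset.sum_congr rfl fun i _ => by ring
  have h3 := delta_mul_norm_sq_le (δ := δ) s.gsq (s.z - z₀)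
  have h4 := abs_real_inner_le_norm (s.z - z₀) s.gsum
  rw [abs_le] at h4
  simp only [adaObj, h2, sub_self, inner_zero_left] at h1
  simp only [PiLp.sub_apply] at h3
  have h5 : δ * ‖s.z - z₀‖ ^ 2 ≤ η * (‖s.z - z₀‖ * ‖s.gsum‖) := by
    have := mul_le_mul_of_nonneg_left h4.1 hη.le
    simp [-Fintype.sum_sum_type] at h1
    linarith
  rcases eq_or_lt_of_le (norm_nonneg (s.z - z₀)) with h | h
  · rw [← h]; simp; positivity
  · nlinarith

/-- The dual averaging invariant: the minimum of the step objective serves as potential, and each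
step costs at most `η²` times the increase of `∑ i, √(gsq i)`. -/
theorem adaGrad_regret_aux (n : ℕ)
    (hb : ∀ t ∈ Finset.Icc 1 n, ∀ i, |adaGrad Z g δ η z₀ t i| ≤ δ) :
    η * ∑ t ∈ Finset.Icc 1 n, inner ℝ (adaGrad Z g δ η z₀ t) (adaIter Z g δ η z₀ t - z₀) ≤
      adaObj δ η z₀ (adaState Z g δ η z₀ n).gsum (adaState Z g δ η z₀ n).gsq
          (adaState Z g δ η z₀ n).z + η ^ 2 * ∑ i, √((adaState Z g δ η z₀ n).gsq i) := by
  induction n with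
  | zero => simp [adaState, adaObj]
  | succ n ih =>
    have ih := ih fun t ht => hb t (Finset.Icc_subset_Icc_right (Nat.le_succ n) ht)
    have hbn := hb (n + 1) (by simp)
    rw [Finset.sum_Icc_succ_top (by omega), mul_add]
    obtain ⟨-, hg⟩ := adaState_mem_and_growth hc hZ (η := η) hδ g hz₀ n
    obtain ⟨hz', -⟩ := adaState_mem_and_growth hc hZ (η := η) hδ g hz₀ (n + 1)
    have hg := hg _ hz'
    have hgs : (adaState Z g δ η z₀ (n + 1)).gsum
      = (adaState Z g δ η z₀ n).gsum + adaGrad Z g δ η z₀ (n + 1) := rfl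
    have hgq : (adaState Z g δ η z₀ (n + 1)).gsq = fun i => (adaState Z g δ η z₀ n).gsq i
      + adaGrad Z g δ η z₀ (n + 1) i ^ 2 := rfl
    have hit : adaIter Z g δ η z₀ (n + 1) = (adaState Z g δ η z₀ n).z := rfl
    have hq0 : ∀ i, 0 ≤ (adaState Z g δ η z₀ n).gsq i := fun i => by
      have h : (adaState Z g δ η z₀ n).gsq i
          = ∑ t ∈ Finset.Icc 1 n, adaGrad Z g δ η z₀ t i ^ 2 := by
        clear * -
        induction n with
        | zero => simp [adaState]
        | succ n ih =>
          rw [Finset.sum_Icc_succ_top (by omega), ← ih]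
          rfl
      rw [h]
      positivity
    rw [hgs, hgq, hit]
    set s := adaState Z g δ η z₀ n
    set v := adaGrad Z g δ η z₀ (n + 1)
    set z' := (adaState Z g δ η z₀ (n + 1)).z
    -- The growth of the old objective from its minimizer `s.z` to `z'` pays for the move. What
    -- remains splits over the coordinates, where it is Young's inequality with weight `δ + √(gsq
    -- i)`.
    suffices hs : η * inner ℝ v (s.z - z₀) + adaObj δ η z₀ s.gsum s.gsq z'
        + η ^ 2 * ∑ i, √(s.gsq i) ≤
        adaObj δ η z₀ (s.gsum + v) (fun i => s.gsq i + v i ^ 2) z'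
          + η ^ 2 * ∑ i, √(s.gsq i + v i ^ 2)
          + 1 / 2 * ∑ i, (δ + √(s.gsq i)) * (z' i - s.z i) ^ 2 by linarith
    simp only [adaObj, joint_inner, Finset.mul_sum, ← Finset.sum_add_distrib]
    refine Finset.sum_le_sum fun i _ => ?_
    simp only [PiLp.sub_apply, PiLp.add_apply]
    have h1 := sq_div_le_sqrt_sub (hq0 i) (hbn i)
    have h2 : √(s.gsq i) ≤ √(s.gsq i + v i ^ 2) := Real.sqrt_le_sqrt (by nlinarith)
    set σ := √(s.gsq i)
    set σ' := √(s.gsq i + v i ^ 2)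
    have hσ : 0 < δ + σ := by positivity
    have h3 : η * v i * (s.z i - z' i) ≤
        η ^ 2 * (σ' - σ) + 1 / 2 * ((δ + σ) * (z' i - s.z i) ^ 2) := by
      have h4 : (η * v i) ^ 2 ≤ 2 * (δ + σ) * (η ^ 2 * (σ' - σ)) := by
        nlinarith [mul_le_mul_of_nonneg_left h1 (sq_nonneg η)]
      have h5 : 0 ≤ ((δ + σ) * (s.z i - z' i) - η * v i) ^ 2 := sq_nonneg _
      have h6 : (δ + σ) * (η * v i * (s.z i - z' i)) ≤
        (δ + σ) * (η ^ 2 * (σ' - σ) + 1 / 2 * ((δ + σ) * (z' i - s.z i) ^ 2)) := by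
        nlinarith
      exact le_of_mul_le_mul_left h6 hσ
    have h7 : 0 ≤ (σ' - σ) * (z' i - z₀ i) ^ 2 := mul_nonneg (sub_nonneg.2 h2) (sq_nonneg _)
    nlinarith

/-- The regret bound of AdaGrad dual averaging. -/
theorem adaGrad_regret (hη : 0 < η) (n : ℕ)
    (hb : ∀ t ∈ Finset.Icc 1 n, ∀ i, |adaGrad Z g δ η z₀ t i| ≤ δ) {w : Joint d d'} (hw : w ∈ Z) :
    ∑ t ∈ Finset.Icc 1 n, inner ℝ (adaGrad Z g δ η z₀ t) (adaIter Z g δ η z₀ t - w) ≤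
      1 / (2 * η) * ∑ i, (δ + adaNorm Z g δ η z₀ n i) * (w i - z₀ i) ^ 2
        + η * ∑ i, adaNorm Z g δ η z₀ n i := by
  have h1 := adaGrad_regret_aux hc hZ (η := η) hδ g hz₀ n hb
  obtain ⟨-, h2⟩ := adaState_mem_and_growth hc hZ (η := η) hδ g hz₀ n
  have h2 := h2 w hw
  have h3 : 0 ≤ ∑ i, (δ + √((adaState Z g δ η z₀ n).gsq i))
            * (w i - (adaState Z g δ η z₀ n).z i) ^ 2 := by positivity
  have h4 : ∑ t ∈ Finset.Icc 1 n, inner ℝ (adaGrad Z g δ η z₀ t) (adaIter Z g δ η z₀ t - w)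
      = ∑ t ∈ Finset.Icc 1 n, inner ℝ (adaGrad Z g δ η z₀ t) (adaIter Z g δ η z₀ t - z₀)
        - inner ℝ (w - z₀) (adaState Z g δ η z₀ n).gsum := by
    rw [adaState_gsum, inner_sum, ← Finset.sum_sub_distrib]
    refine Finset.sum_congr rfl fun t _ => ?_
    rw [real_inner_comm _ (w - z₀), ← inner_sub_right]
    congr 1
    abel
  rw [h4]
  simp only [← sqrt_adaState_gsq]
  unfold adaObj at h1 h2
  set A := ∑ t ∈ Finset.Icc 1 n, inner ℝ (adaGrad Z g δ η z₀ t) (adaIter Z g δ η z₀ t - z₀)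
  set B := ∑ i, (δ + √((adaState Z g δ η z₀ n).gsq i)) * (w i - z₀ i) ^ 2
  have h5 : η * (A - inner ℝ (w - z₀) (adaState Z g δ η z₀ n).gsum) ≤
      η * (1 / (2 * η) * B + η * ∑ i, √((adaState Z g δ η z₀ n).gsq i)) := by
    have : η * (1 / (2 * η) * B) = 1 / 2 * B := by field_simp
    rw [mul_add, this]
    linarith
  exact le_of_mul_le_mul_left h5 hη

end State

/-! ### From regret to the proximal gap, path by path. -/

theorem joint_inner_parts (z w : Joint d d') :
    inner ℝ z w = inner ℝ (xPart z) (xPart w) + inner ℝ (yPart z) (yPart w) := by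
  simp [PiLp.inner_apply, Fintype.sum_sum_type, xPart, yPart]

theorem joint_norm_sq_parts (z : Joint d d') : ‖z‖ ^ 2 = ‖xPart z‖ ^ 2 + ‖yPart z‖ ^ 2 := by
  simp only [← real_inner_self_eq_norm_sq, joint_inner_parts]

@[simp] theorem xPart_join (x : Vec d) (y : Vec d') : xPart (join x y) = x := rfl
@[simp] theorem yPart_join (x : Vec d) (y : Vec d') : yPart (join x y) = y := rfl
@[simp] theorem xPart_add (z w : Joint d d') : xPart (z + w) = xPart z + xPart w := rfl
@[simp] theorem yPart_add (z w : Joint d d') : yPart (z + w) = yPart z + yPart w := rfl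
@[simp] theorem xPart_sub (z w : Joint d d') : xPart (z - w) = xPart z - xPart w := rfl
@[simp] theorem yPart_sub (z w : Joint d d') : yPart (z - w) = yPart z - yPart w := rfl

@[fun_prop] theorem continuous_xPart : Continuous (xPart : Joint d d' → Vec d) := by
  unfold xPart; fun_prop

@[fun_prop] theorem continuous_yPart : Continuous (yPart : Joint d d' → Vec d') := by
  unfold yPart; fun_prop

theorem continuous_join_left (y : Vec d') : Continuous (fun x : Vec d => join x y) := by
  have : ∀ i : Fin d ⊕ Fin d', Continuous fun x : Vec d =>
      Sum.elim (fun i => x i) (fun j => y j) i := by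
    rintro (i | j)
    · simp only [Sum.elim_inl]; fun_prop
    · simp only [Sum.elim_inr]; fun_prop
  unfold join
  fun_prop

theorem isClosed_feasible {Y : Set (Vec d')} (hY : IsClosed Y) :
    IsClosed (feasible (d := d) Y) := hY.preimage continuous_yPart

theorem convex_feasible {Y : Set (Vec d')} (hY : Convex ℝ Y) :
    Convex ℝ (feasible (d := d) Y) := fun _ hz _ hw _ _ ha hb hab => hY hz hw ha hb hab

/-- The gradient field of the proximal objective `f(x, y) + (γ/2) ‖x - x_ref‖²`. -/
def proxField (f : Vec d → Vec d' → ℝ) (γ : ℝ) (zref z : Joint d d') : Joint d d' :=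
  field f z + join (γ • (xPart z - xPart zref)) 0

section Pathwise

variable {Y : Set (Vec d')} {f : Vec d → Vec d' → ℝ} {ℓ L ρ μ μx μy : ℝ}

theorem IsProblem.prox_convex (h : IsProblem Y f ℓ L ρ μ μx μy) (hμ : 0 < μ) (hρ : ρ ≤ μ / 8)
    (q x x' : Vec d) {y : Vec d'} (hy : y ∈ Y) :
    f x' y + μ / 8 * ‖x' - q‖ ^ 2 + inner ℝ (gradX f x' y + (μ / 4) • (x' - q)) (x - x') ≤
      f x y + μ / 8 * ‖x - q‖ ^ 2 := by
  have h1 := h.weakConvex y hy x x'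
  have h2 : ‖x - q‖ ^ 2 = ‖x - x'‖ ^ 2 + 2 * inner ℝ (x - x') (x' - q) + ‖x' - q‖ ^ 2 := by
    rw [← norm_add_sq_real]
    congr 2
    abel
  rw [inner_add_left, inner_smul_left, real_inner_comm (x - x') (x' - q), h2]
  have h3 := mul_le_mul_of_nonneg_right hρ (sq_nonneg ‖x - x'‖)
  have h4 : 0 ≤ μ * ‖x - x'‖ ^ 2 := by positivity
  simp
  linarith

/-- Jensen's inequality in tangent form: each summand is compared with the linearization at the
average `zb`, and the linear terms cancel because `∑ (z t - zb) = 0`. -/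
theorem IsProblem.sum_convex (h : IsProblem Y f ℓ L ρ μ μx μy) (hμ : 0 < μ) (hμy : 0 < μy)
    (hρ : ρ ≤ μ / 8) (zref : Joint d d') {T : ℕ} (hT : 1 ≤ T) (z : ℕ → Joint d d')
    (hz : ∀ t ∈ Finset.Icc 1 T, z t ∈ feasible (d := d) Y) {zb : Joint d d'}
    (hzb : zb = (1 / (T : ℝ)) • ∑ t ∈ Finset.Icc 1 T, z t) (hzbY : zb ∈ feasible (d := d) Y)
    (w : Joint d d') (hw : w ∈ feasible (d := d) Y) :
    T * (f (xPart zb) (yPart w) + μ / 8 * ‖xPart zb - xPart zref‖ ^ 2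
        - (f (xPart w) (yPart zb) + μ / 8 * ‖xPart w - xPart zref‖ ^ 2)) ≤
      ∑ t ∈ Finset.Icc 1 T, inner ℝ (proxField f (μ / 4) zref (z t)) (z t - w) := by
  have hTpos : (0 : ℝ) < T := by exact_mod_cast hT
  have hsum : ∑ t ∈ Finset.Icc 1 T, (z t - zb) = 0 := by
    rw [Finset.sum_sub_distrib, Finset.sum_const, Nat.card_Icc, Nat.add_sub_cancel,
      ← Nat.cast_smul_eq_nsmul ℝ, hzb, smul_smul, mul_one_div_cancel hTpos.ne', one_smul, sub_self]
  set a := gradX f (xPart zb) (yPart w) + (μ / 4) • (xPart zb - xPart zref)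
  set b := gradY f (xPart w) (yPart zb)
  have key : ∀ t ∈ Finset.Icc 1 T,
      f (xPart zb) (yPart w) + μ / 8 * ‖xPart zb - xPart zref‖ ^ 2
        - (f (xPart w) (yPart zb) + μ / 8 * ‖xPart w - xPart zref‖ ^ 2) ≤
      inner ℝ (proxField f (μ / 4) zref (z t)) (z t - w) - inner ℝ (join a (-b)) (z t - zb) := by
    intro t ht
    have hzt := hz t ht
    have h1 := h.prox_convex hμ hρ (xPart zref) (xPart (z t)) (xPart zb) hw
    have h2 := h.prox_convex hμ hρ (xPart zref) (xPart w) (xPart (z t)) hzt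
    have h3 := strongConcaveOn_le_of_gradient (h.strongConcave (xPart (z t))) hw hzt
      (h.diff_y _ _ hzt)
    have h4 := strongConcaveOn_le_of_gradient (h.strongConcave (xPart w)) hzt hzbY
      (h.diff_y _ _ hzbY)
    have h5 : 0 ≤ μy / 2 * ‖yPart w - yPart (z t)‖ ^ 2 := by positivity
    have h6 : 0 ≤ μy / 2 * ‖yPart (z t) - yPart zb‖ ^ 2 := by positivity
    change _ ≤ _ + inner ℝ (gradY f (xPart (z t)) (yPart (z t))) _ - _ at h3
    change _ ≤ _ + inner ℝ b _ - _ at h4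
    change _ + inner ℝ a _ ≤ _ at h1
    rw [joint_inner_parts, joint_inner_parts]
    simp only [proxField, field, xPart_add, yPart_add, xPart_join, yPart_join, xPart_sub, yPart_sub,
      add_zero, inner_neg_left]
    rw [← neg_sub (xPart (z t)) (xPart w), inner_neg_right] at h2
    rw [← neg_sub (yPart (z t)) (yPart w)] at h3 h5
    rw [inner_neg_right] at h3
    linarith
  have := Finset.sum_le_sum key
  rw [Finset.sum_const, Nat.card_Icc, Nat.add_sub_cancel, nsmul_eq_mul, Finset.sum_sub_distrib,
    ← inner_sum, hsum, inner_zero_right, sub_zero] at this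
  exact this

/-- The stochastic error of an epoch: a bound on the proximal gap of the average iterate up to the
quadratic distance of the comparison point from the center. -/
def epochNoise (f : Vec d → Vec d' → ℝ) (μ η A B : ℝ) (zref : Joint d d') (T : ℕ)
    (z v : ℕ → Joint d d') : ℝ :=
  (η * B + ∑ t ∈ Finset.Icc 1 T, inner ℝ (proxField f (μ / 4) zref (z t) - v t) (z t - zref)
    + η / (2 * A) * ‖∑ t ∈ Finset.Icc 1 T, (proxField f (μ / 4) zref (z t) - v t)‖ ^ 2) / T

theorem adaAverage_mem {Z : Set (Joint d d')} (hc : IsClosed Z) (hZ : Convex ℝ Z) {δ η : ℝ}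
    (hδ : 0 < δ) (g : ℕ → Joint d d' → Joint d d') {z₀ : Joint d d'} (hz₀ : z₀ ∈ Z) {T : ℕ}
    (hT : 1 ≤ T) : adaAverage Z g δ η z₀ T ∈ Z := by
  have hTpos : (0 : ℝ) < T := by exact_mod_cast hT
  unfold adaAverage
  rw [Finset.smul_sum]
  refine hZ.sum_mem (fun _ _ => by positivity) ?_
    fun t _ => (adaState_mem_and_growth hc hZ hδ g hz₀ _).1
  rw [Finset.sum_const, Nat.card_Icc, Nat.add_sub_cancel, nsmul_eq_mul]
  field_simp

theorem IsProblem.epoch_bound (h : IsProblem Y f ℓ L ρ μ μx μy) (hμ : 0 < μ) (hμy : 0 < μy)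
    (hρ : ρ ≤ μ / 8) {δ η A B : ℝ} (hδ : 0 < δ) (hη : 0 < η) (hA : 0 < A)
    (g : ℕ → Joint d d' → Joint d d') {zref : Joint d d'} (hzref : zref ∈ feasible (d := d) Y)
    {T : ℕ} (hT : 1 ≤ T)
    (hb : ∀ t ∈ Finset.Icc 1 T, ∀ i, |adaGrad (feasible Y) g δ η zref t i| ≤ δ)
    (hmax : ∀ i, δ + adaNorm (feasible Y) g δ η zref T i ≤ A)
    (hsum : ∑ i, adaNorm (feasible Y) g δ η zref T i ≤ B)
    (hAT : A = min (μ / 8) μy / 384 * (η * T)) :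
    191 * proxGap Y f μ (xPart zref) (xPart (adaAverage (feasible Y) g δ η zref T))
        (yPart (adaAverage (feasible Y) g δ η zref T)) ≤
      proxGap Y f μ (xPart zref) (xPart zref) (yPart zref) +
        192 * epochNoise f μ η A B zref T (adaIter (feasible Y) g δ η zref)
          (adaGrad (feasible Y) g δ η zref) := by
  have hTpos : (0 : ℝ) < T := by exact_mod_cast hT
  have hc := isClosed_feasible (d := d) h.closed
  have hZ := convex_feasible (d := d) h.convex
  have hav := adaAverage_mem hc hZ (η := η) hδ g hzref hT
  refine h.proxGap_le_of_forall hμ hμy hρ _ _ hav hzref fun x' y' hy' => ?_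
  set zb := adaAverage (feasible Y) g δ η zref T with hzb
  set w : Joint d d' := join x' y'
  have hw : w ∈ feasible (d := d) Y := hy'
  have h1 := h.sum_convex hμ hμy hρ zref hT (adaIter (feasible Y) g δ η zref)
    (fun t _ => (adaState_mem_and_growth hc hZ hδ g hzref _).1) hzb hav w hw
  have h2 := adaGrad_regret hc hZ hδ g hzref hη T hb hw
  set z := adaIter (feasible Y) g δ η zref
  set v := adaGrad (feasible Y) g δ η zref
  set D := ∑ t ∈ Finset.Icc 1 T, (proxField f (μ / 4) zref (z t) - v t) with hD
  have h3 : ∑ t ∈ Finset.Icc 1 T, inner ℝ (proxField f (μ / 4) zref (z t)) (z t - w)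
      = ∑ t ∈ Finset.Icc 1 T, inner ℝ (v t) (z t - w)
        + ∑ t ∈ Finset.Icc 1 T, inner ℝ (proxField f (μ / 4) zref (z t) - v t) (z t - zref)
        - inner ℝ D (w - zref) := by
    rw [hD, sum_inner, ← Finset.sum_add_distrib, ← Finset.sum_sub_distrib]
    refine Finset.sum_congr rfl fun t _ => ?_
    simp only [inner_sub_left, inner_sub_right]
    ring
  have h4 : ∑ i, (δ + adaNorm (feasible Y) g δ η zref T i) * (w i - zref i) ^ 2 ≤
      A * ‖w - zref‖ ^ 2 := by
    rw [joint_norm_sq, Finset.mul_sum]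
    refine Finset.sum_le_sum fun i _ => ?_
    exact mul_le_mul_of_nonneg_right (hmax i) (sq_nonneg _)
  -- The comparison point is arbitrary and may depend on the samples, so it is separated from the
  -- error `D`.
  have h5 : - inner ℝ D (w - zref) ≤ A / (2 * η) * ‖w - zref‖ ^ 2 + η / (2 * A) * ‖D‖ ^ 2 := by
    have h6 := abs_real_inner_le_norm D (w - zref)
    have h7 := (abs_le.1 h6).1
    have h8 : 0 ≤ (A * ‖w - zref‖ - η * ‖D‖) ^ 2 := sq_nonneg _
    have h9 : ‖D‖ * ‖w - zref‖ ≤ A / (2 * η) * ‖w - zref‖ ^ 2 + η / (2 * A) * ‖D‖ ^ 2 := by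
      have : A / (2 * η) * ‖w - zref‖ ^ 2 + η / (2 * A) * ‖D‖ ^ 2 - ‖D‖ * ‖w - zref‖
          = (A * ‖w - zref‖ - η * ‖D‖) ^ 2 / (2 * A * η) := by
        field_simp
        ring
      have : 0 ≤ (A * ‖w - zref‖ - η * ‖D‖) ^ 2 / (2 * A * η) := by positivity
      linarith
    linarith
  have h6 := mul_le_mul_of_nonneg_left h4 (by positivity : 0 ≤ 1 / (2 * η))
  have h7 := mul_le_mul_of_nonneg_left hsum hη.le
  -- The regret and Young's inequality contribute equal quadratic terms; `hAT` is chosen so that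
  -- they add up to the tolerance of `IsProblem.proxGap_le_of_forall`.
  have h8 : 1 / (2 * η) * (A * ‖w - zref‖ ^ 2) + A / (2 * η) * ‖w - zref‖ ^ 2
      = T * (min (μ / 8) μy / 384 * ‖w - zref‖ ^ 2) := by
    rw [hAT]
    field_simp
    ring
  have h9 : ‖w - zref‖ ^ 2 = ‖x' - xPart zref‖ ^ 2 + ‖y' - yPart zref‖ ^ 2 :=
    joint_norm_sq_parts _
  rw [h9] at h8
  have h10 : T * epochNoise f μ η A B zref T z v = η * B
      + ∑ t ∈ Finset.Icc 1 T, inner ℝ (proxField f (μ / 4) zref (z t) - v t) (z t - zref)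
      + η / (2 * A) * ‖D‖ ^ 2 := by
    rw [epochNoise, mul_div_cancel₀ _ hTpos.ne']
  have h11 : (T : ℝ) * (f (xPart zb) y' + μ / 8 * ‖xPart zb - xPart zref‖ ^ 2
        - (f x' (yPart zb) + μ / 8 * ‖x' - xPart zref‖ ^ 2)) ≤
      T * (min (μ / 8) μy / 384 * (‖x' - xPart zref‖ ^ 2 + ‖y' - yPart zref‖ ^ 2)
        + epochNoise f μ η A B zref T z v) := by
    rw [mul_add, h10, ← h8]
    rw [h9] at h5 h6
    simp only [w, xPart_join, yPart_join] at h1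
    linarith
  exact le_of_mul_le_mul_left h11 hTpos

end Pathwise

/-! ### Measurability and feasibility of the iterates. -/

section Measurable

variable {Ω' Ξ : Type*} {mΩ' : MeasurableSpace Ω'}

theorem adaState_succ_z (Z : Set (Joint d d')) (g : ℕ → Joint d d' → Joint d d') (δ η : ℝ)
    (z₀ : Joint d d') (n : ℕ) :
    (adaState Z g δ η z₀ (n + 1)).z = adaStep Z δ η ((n : ℝ) + 1) z₀
      (adaState Z g δ η z₀ (n + 1)).gsum (adaState Z g δ η z₀ (n + 1)).gsq := rfl

theorem _root_.Continuous.measurable_comp_triple {E F : Type*} [MeasurableSpace E]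
    [TopologicalSpace E] [BorelSpace E] [SecondCountableTopology E] [MeasurableSpace F]
    [TopologicalSpace F] [BorelSpace F] [SecondCountableTopology F] {A : E × E × F → E}
    (hA : Continuous A) {u v : Ω' → E} {b : Ω' → F} (hu : Measurable u) (hv : Measurable v)
    (hb : Measurable b) : Measurable fun ω => A (u ω, v ω, b ω) :=
  hA.measurable.comp (hu.prodMk (hv.prodMk hb))

theorem measurable_adaStep {Z : Set (Joint d d')} (hc : IsClosed Z) (hZ : Convex ℝ Z)
    (hne : Z.Nonempty) {δ η t : ℝ} (hδ : 0 < δ) (ht : 0 < t) {z₀ S : Ω' → Joint d d'}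
    {b : Ω' → Fin d ⊕ Fin d' → ℝ} (hz₀ : Measurable z₀) (hS : Measurable S) (hb : Measurable b) :
    Measurable fun ω => adaStep Z δ η t (z₀ ω) (S ω) (b ω) := by
  have := (continuous_adaStep hc hZ hne (η := η) hδ ht).measurable_comp_triple hz₀ hS hb
  exact this

theorem measurable_adaState {Z : Set (Joint d d')} (hc : IsClosed Z) (hZ : Convex ℝ Z)
    (hne : Z.Nonempty) {δ η : ℝ} (hδ : 0 < δ) {z₀ : Ω' → Joint d d'} (hz₀ : Measurable z₀)
    {g : Ω' → ℕ → Joint d d' → Joint d d'} (n : ℕ)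
    (hg : ∀ t ∈ Finset.Icc 1 n, ∀ z : Ω' → Joint d d', Measurable z →
      Measurable fun ω => g ω t (z ω)) :
    Measurable (fun ω => (adaState Z (g ω) δ η (z₀ ω) n).z) ∧
    Measurable (fun ω => (adaState Z (g ω) δ η (z₀ ω) n).gsum) ∧
    Measurable (fun ω => (adaState Z (g ω) δ η (z₀ ω) n).gsq) := by
  induction n with
  | zero => exact ⟨hz₀, measurable_const, measurable_const⟩
  | succ n ih =>
    obtain ⟨h1, h2, h3⟩ := ih fun t ht => hg t (Finset.Icc_subset_Icc_right (Nat.le_succ n) ht)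
    have h4 := hg (n + 1) (by simp) _ h1
    have h5 : Measurable (fun ω => (adaState Z (g ω) δ η (z₀ ω) (n + 1)).gsum) := h2.add h4
    have h6 : Measurable (fun ω => (adaState Z (g ω) δ η (z₀ ω) (n + 1)).gsq) := by
      refine measurable_pi_iff.2 fun i => ?_
      have : Measurable fun z : Joint d d' => z i := by fun_prop
      exact ((measurable_pi_apply i).comp h3).add ((this.comp h4).pow_const 2)
    refine ⟨?_, h5, h6⟩
    simp only [adaState_succ_z]
    exact measurable_adaStep hc hZ hne hδ (by positivity) hz₀ h5 h6

theorem measurable_proxOracle [MeasurableSpace Ξ] {G : Joint d d' → Ξ → Joint d d'}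
    (hG : Measurable (Function.uncurry G)) (γ : ℝ) {zref z : Ω' → Joint d d'}
    (hzref : Measurable zref) (hz : Measurable z) {ξ : Ω' → ℕ → Ξ} {t : ℕ}
    (hξ : Measurable fun ω => ξ ω t) :
    Measurable fun ω => proxOracle G γ (zref ω) (ξ ω) t (z ω) := by
  have h1 : Measurable fun ω => G (z ω) (ξ ω t) := hG.comp (hz.prodMk hξ)
  have h2 : Measurable fun ω => γ • (xPart (z ω) - xPart (zref ω)) :=
    ((continuous_xPart.measurable.comp hz).sub (continuous_xPart.measurable.comp hzref)).const_smul γ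
  have h3 : Measurable fun ω => (join (γ • (xPart (z ω) - xPart (zref ω))) 0 : Joint d d') :=
    (continuous_join_left 0).measurable.comp h2
  exact Measurable.add (M := Joint d d') h1 h3

theorem measurable_pes [MeasurableSpace Ξ] {Y : Set (Vec d')} (hc : IsClosed Y) (hY : Convex ℝ Y)
    {G : Joint d d' → Ξ → Joint d d'} (hG : Measurable (Function.uncurry G)) {p : Params}
    (hδ : 0 < p.δ) {z₀ : Joint d d'} (hz₀ : z₀ ∈ feasible (d := d) Y) {ξ : Ω' → ℕ → ℕ → Ξ} (k : ℕ)
    (hξ : ∀ j ∈ Finset.Icc 1 k, ∀ t, Measurable fun ω => ξ ω j t) :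
    Measurable fun ω => pes Y G p z₀ (ξ ω) k := by
  induction k with
  | zero => exact measurable_const
  | succ k ih =>
    have h1 := ih fun j hj => hξ j (Finset.Icc_subset_Icc_right (Nat.le_succ k) hj)
    change Measurable fun ω => (1 / (p.T (k + 1) : ℝ)) • ∑ t ∈ Finset.Icc 1 (p.T (k + 1)), _
    refine Measurable.const_smul (M := ℝ) (X := Joint d d')
      (Finset.measurable_fun_sum _ fun t _ => ?_) _
    exact (measurable_adaState (isClosed_feasible hc) (convex_feasible hY) ⟨z₀, hz₀⟩ hδ h1 (t - 1)
      (fun s _ z hz => measurable_proxOracle hG p.γ h1 hz (hξ (k + 1) (by simp) s))).1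

theorem pes_mem {Y : Set (Vec d')} (hc : IsClosed Y) (hY : Convex ℝ Y)
    {G : Joint d d' → Ξ → Joint d d'} {p : Params} (hT : ∀ k, 1 ≤ p.T k)
    (hδ : 0 < p.δ) {z₀ : Joint d d'} (hz₀ : z₀ ∈ feasible (d := d) Y) (ξ : ℕ → ℕ → Ξ) (k : ℕ) :
    pes Y G p z₀ ξ k ∈ feasible (d := d) Y := by
  induction k with
  | zero => exact hz₀
  | succ k ih =>
    exact adaAverage_mem (isClosed_feasible hc) (convex_feasible hY) hδ _ ih (hT _)

end Measurable

/-! ### Bounded random variables. -/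

section Bounded

variable {Ω : Type*} {mΩ : MeasurableSpace Ω} {prob : Measure Ω}

/-- Measurable and almost surely bounded real random variables. -/
def AEBounded (prob : Measure Ω) (X : Ω → ℝ) : Prop :=
  Measurable X ∧ ∃ C : ℝ, ∀ᵐ ω ∂prob, |X ω| ≤ C

theorem AEBounded.integrable [IsFiniteMeasure prob] {X : Ω → ℝ} (h : AEBounded prob X) :
    Integrable X prob := by
  obtain ⟨hm, C, hC⟩ := h
  exact Integrable.of_bound hm.aestronglyMeasurable C hC

theorem AEBounded.const (c : ℝ) : AEBounded prob (fun _ => c) :=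
  ⟨measurable_const, |c|, by simp⟩

theorem AEBounded.add {X X' : Ω → ℝ} (h : AEBounded prob X) (h' : AEBounded prob X') :
    AEBounded prob (fun ω => X ω + X' ω) := by
  obtain ⟨hm, C, hC⟩ := h
  obtain ⟨hm', C', hC'⟩ := h'
  refine ⟨hm.add hm', C + C', ?_⟩
  filter_upwards [hC, hC'] with ω h1 h2
  exact (abs_add_le _ _).trans (add_le_add h1 h2)

theorem AEBounded.mul {X X' : Ω → ℝ} (h : AEBounded prob X) (h' : AEBounded prob X') :
    AEBounded prob (fun ω => X ω * X' ω) := by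
  obtain ⟨hm, C, hC⟩ := h
  obtain ⟨hm', C', hC'⟩ := h'
  refine ⟨hm.mul hm', C * C', ?_⟩
  filter_upwards [hC, hC'] with ω h1 h2
  rw [abs_mul]
  exact mul_le_mul h1 h2 (abs_nonneg _) ((abs_nonneg _).trans h1)

theorem AEBounded.sub {X X' : Ω → ℝ} (h : AEBounded prob X) (h' : AEBounded prob X') :
    AEBounded prob (fun ω => X ω - X' ω) := by
  have := h.add ((AEBounded.const (-1)).mul h')
  simpa [sub_eq_add_neg] using this

theorem AEBounded.sum {ι : Type*} {s : Finset ι} {X : ι → Ω → ℝ}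
    (h : ∀ i ∈ s, AEBounded prob (X i)) : AEBounded prob (fun ω => ∑ i ∈ s, X i ω) := by
  classical
  induction s using Finset.induction_on with
  | empty => simpa using AEBounded.const (prob := prob) 0
  | insert a s ha ih =>
    simp only [Finset.sum_insert ha]
    exact (h a (by simp)).add (ih fun i hi => h i (by simp [hi]))

end Bounded

/-! ### Independence: replacing a stochastic gradient by its mean. -/

section Oracle

variable {Ω Ξ : Type*} {mΩ : MeasurableSpace Ω} {mΞ : MeasurableSpace Ξ} {prob : Measure Ω}
  {Y : Set (Vec d')} {f : Vec d → Vec d' → ℝ} {G : Joint d d' → Ξ → Joint d d'}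
  {ξ : ℕ → ℕ → Ω → Ξ}

/-- Fubini for the product law. It freezes the past `W` and averages over the fresh sample `X`, in
place of a conditional expectation. -/
theorem integral_eq_integral_integral_of_indepFun [IsProbabilityMeasure prob] {β : Type*}
    [MeasurableSpace β] {W : Ω → β} {X : Ω → Ξ} (hW : Measurable W) (hX : Measurable X)
    (hind : IndepFun W X prob) {H : β × Ξ → ℝ} (hH : Measurable H)
    (hint : Integrable (fun ω => H (W ω, X ω)) prob) :
    ∫ ω, H (W ω, X ω) ∂prob = ∫ ω, ∫ ω', H (W ω, X ω') ∂prob ∂prob := by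
  have hmap := (indepFun_iff_map_prod_eq_prod_map_map hW.aemeasurable hX.aemeasurable).1 hind
  have hP := Measure.isProbabilityMeasure_map (μ := prob) hW.aemeasurable
  have hP' := Measure.isProbabilityMeasure_map (μ := prob) hX.aemeasurable
  have hWX : Measurable fun ω => (W ω, X ω) := hW.prodMk hX
  have h1 : Integrable H ((prob.map W).prod (prob.map X)) := by
    rw [← hmap, integrable_map_measure hH.aestronglyMeasurable hWX.aemeasurable]
    exact hint
  have h2 : StronglyMeasurable fun b => ∫ x, H (b, x) ∂(prob.map X) :=
    hH.stronglyMeasurable.integral_prod_right'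
  calc ∫ ω, H (W ω, X ω) ∂prob = ∫ y, H y ∂(prob.map fun ω => (W ω, X ω)) :=
        (integral_map hWX.aemeasurable hH.aestronglyMeasurable).symm
    _ = ∫ b, ∫ x, H (b, x) ∂(prob.map X) ∂(prob.map W) := by rw [hmap, integral_prod _ h1]
    _ = ∫ ω, ∫ x, H (W ω, x) ∂(prob.map X) ∂prob :=
        integral_map hW.aemeasurable h2.aestronglyMeasurable
    _ = ∫ ω, ∫ ω', H (W ω, X ω') ∂prob ∂prob := by
        refine integral_congr_ae (Eventually.of_forall fun ω => ?_)
        exact integral_map hX.aemeasurable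
          (hH.comp measurable_prodMk_left).aestronglyMeasurable

theorem ae_ae_of_indepFun [IsProbabilityMeasure prob] {β : Type*}
    [MeasurableSpace β] {W : Ω → β} {X : Ω → Ξ} (hW : Measurable W) (hX : Measurable X)
    (hind : IndepFun W X prob) {S : Set (β × Ξ)} (hS : MeasurableSet S)
    (hae : ∀ᵐ ω ∂prob, (W ω, X ω) ∈ S) :
    ∀ᵐ ω ∂prob, ∀ᵐ ω' ∂prob, (W ω, X ω') ∈ S := by
  have hmap := (indepFun_iff_map_prod_eq_prod_map_map hW.aemeasurable hX.aemeasurable).1 hind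
  have hP := Measure.isProbabilityMeasure_map (μ := prob) hW.aemeasurable
  have hP' := Measure.isProbabilityMeasure_map (μ := prob) hX.aemeasurable
  have hWX : Measurable fun ω => (W ω, X ω) := hW.prodMk hX
  have h1 : ∀ᵐ y ∂((prob.map W).prod (prob.map X)), y ∈ S := by
    rw [← hmap]
    exact (ae_map_iff hWX.aemeasurable hS).2 hae
  have h2 := ae_of_ae_map hW.aemeasurable (Measure.ae_ae_of_ae_prod h1)
  filter_upwards [h2] with ω h3
  exact ae_of_ae_map hX.aemeasurable h3

/-- The `σ`-algebra of the samples used before step `t` of epoch `k`. -/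
abbrev past {Ω Ξ : Type*} [mΞ : MeasurableSpace Ξ] (ξ : ℕ → ℕ → Ω → Ξ) (k t : ℕ) :
    MeasurableSpace Ω :=
  ⨆ p ∈ {p : ℕ × ℕ | p.1 < k ∨ (p.1 = k ∧ p.2 < t)}, mΞ.comap (ξ p.1 p.2)

theorem measurable_past {k t j s : ℕ} (hjs : j < k ∨ (j = k ∧ s < t)) :
    Measurable[past ξ k t] (ξ j s) := by
  refine measurable_iff_comap_le.2 ?_
  exact le_iSup₂_of_le (f := fun (p : ℕ × ℕ)
    (_ : p ∈ {p : ℕ × ℕ | p.1 < k ∨ (p.1 = k ∧ p.2 < t)}) => mΞ.comap (ξ p.1 p.2)) (j, s) hjs le_rfl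

theorem past_mono {k t s : ℕ} (hts : t ≤ s) : past ξ k t ≤ past ξ k s := by
  refine iSup₂_le fun p hp => ?_
  refine measurable_iff_comap_le.1 (measurable_past ?_)
  rcases hp with hp | ⟨h1, h2⟩
  · exact Or.inl hp
  · exact Or.inr ⟨h1, by omega⟩

theorem IsOracle.past_le (h : IsOracle prob Y f G ξ) (k t : ℕ) : past ξ k t ≤ mΩ :=
  iSup₂_le fun p _ => measurable_iff_comap_le.1 (h.measurable_sample p.1 p.2)

theorem IsOracle.indepFun_past (h : IsOracle prob Y f G ξ) {k t : ℕ} {β : Type*}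
    [MeasurableSpace β] {W : Ω → β} (hW : Measurable[past ξ k t] W) :
    IndepFun W (ξ k t) prob := by
  have h1 := (iIndepFun_iff_iIndep _ _ _).1 h.indep
  have h2 := indep_iSup_of_disjoint
    (fun p => measurable_iff_comap_le.1 (h.measurable_sample p.1 p.2)) h1
    (S := {p : ℕ × ℕ | p.1 < k ∨ (p.1 = k ∧ p.2 < t)}) (T := {(k, t)}) (by
      rw [Set.disjoint_singleton_right]
      simp)
  rw [IndepFun_iff_Indep]
  refine indep_of_indep_of_le_left (indep_of_indep_of_le_right h2 ?_) hW.comap_le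
  simp

/-- On the feasible set the field is the mean of the jointly measurable oracle, hence a measurable
parametric integral. -/
theorem measurable_proxField (h : IsOracle prob Y f G ξ) [IsProbabilityMeasure prob]
    {Ω' : Type*} {mΩ' : MeasurableSpace Ω'} (γ : ℝ)
    {zref z : Ω' → Joint d d'} (hzref : Measurable zref) (hz : Measurable z)
    (hzY : ∀ ω, z ω ∈ feasible (d := d) Y) :
    Measurable fun ω => proxField f γ (zref ω) (z ω) := by
  have h1 : StronglyMeasurable fun z : Joint d d' => ∫ ω, G z (ξ 0 0 ω) ∂prob := by
    have : Measurable fun q : Joint d d' × Ω => G q.1 (ξ 0 0 q.2) :=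
      h.measurable_oracle.comp
        (measurable_fst.prodMk ((h.measurable_sample 0 0).comp measurable_snd))
    exact this.stronglyMeasurable.integral_prod_right'
  have h2 : Measurable fun ω => field f (z ω) := by
    have : (fun ω => field f (z ω)) = fun ω => ∫ ω', G (z ω) (ξ 0 0 ω') ∂prob :=
      funext fun ω => (h.unbiased 0 0 _ (hzY ω)).symm
    rw [this]
    exact h1.measurable.comp hz
  have h3 : Measurable fun ω => γ • (xPart (z ω) - xPart (zref ω)) :=
    ((continuous_xPart.measurable.comp hz).sub (continuous_xPart.measurable.comp hzref)).const_smul γ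
  have h4 : Measurable fun ω => (join (γ • (xPart (z ω) - xPart (zref ω))) 0 : Joint d d') :=
    (continuous_join_left 0).measurable.comp h3
  exact Measurable.add (M := Joint d d') h2 h4

theorem measurable_coord (i : Fin d ⊕ Fin d') : Measurable fun z : Joint d d' => z i := by
  fun_prop

theorem IsOracle.integral_coord (h : IsOracle prob Y f G ξ) [IsProbabilityMeasure prob] (k t : ℕ)
    (γ : ℝ) (zref : Joint d d') {z : Joint d d'} (hz : z ∈ feasible (d := d) Y)
    (i : Fin d ⊕ Fin d') :
    ∫ ω, proxOracle G γ zref (fun s => ξ k s ω) t z i ∂prob = proxField f γ zref z i := by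
  have h1 : ∫ ω, G z (ξ k t ω) i ∂prob = (∫ ω, G z (ξ k t ω) ∂prob) i :=
    (EuclideanSpace.proj (𝕜 := ℝ) i : Joint d d' →L[ℝ] ℝ).integral_comp_comm
      (h.integrable k t z hz)
  have h2 : Integrable (fun ω => G z (ξ k t ω) i) prob :=
    (EuclideanSpace.proj (𝕜 := ℝ) i : Joint d d' →L[ℝ] ℝ).integrable_comp (h.integrable k t z hz)
  rw [h.unbiased k t z hz] at h1
  simp only [proxOracle, proxField, PiLp.add_apply]
  rw [integral_add h2 (integrable_const _), integral_const]
  rw [h1]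
  simp

section Step

variable [IsProbabilityMeasure prob] (h : IsOracle prob Y f G ξ) {k t : ℕ} (γ : ℝ)
  {zref z : Ω → Joint d d'} (hzref : Measurable[past ξ k t] zref) (hz : Measurable[past ξ k t] z)
  (hzY : ∀ ω, z ω ∈ feasible (d := d) Y) (i : Fin d ⊕ Fin d')
include h hzref hz hzY

/-- The bound on the oracle holds for almost every frozen past and almost every fresh sample, so it
survives averaging over the sample. -/
theorem IsOracle.abs_proxField_le {δ : ℝ}
    (hV : ∀ᵐ ω ∂prob, |proxOracle G γ (zref ω) (fun s => ξ k s ω) t (z ω) i| ≤ δ) :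
    ∀ᵐ ω ∂prob, |proxField f γ (zref ω) (z ω) i| ≤ δ := by
  have hind := h.indepFun_past (hzref.prodMk hz)
  have hle := h.past_le k t
  have hS : MeasurableSet {q : (Joint d d' × Joint d d') × Ξ |
      |proxOracle G γ q.1.1 (fun _ : ℕ => q.2) 0 q.1.2 i| ≤ δ} := by
    have h1 : Measurable fun q : (Joint d d' × Joint d d') × Ξ =>
        proxOracle G γ q.1.1 (fun _ : ℕ => q.2) 0 q.1.2 :=
      measurable_proxOracle (ξ := fun (q : (Joint d d' × Joint d d') × Ξ) (_ : ℕ) => q.2) (t := 0)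
        h.measurable_oracle γ measurable_fst.fst measurable_fst.snd measurable_snd
    exact measurableSet_le (continuous_abs.measurable.comp ((measurable_coord i).comp h1))
      measurable_const
  have hae := ae_ae_of_indepFun ((hzref.mono hle le_rfl).prodMk (hz.mono hle le_rfl))
    (h.measurable_sample k t) hind hS hV
  filter_upwards [hae] with ω hω
  rw [← h.integral_coord k t γ (zref ω) (hzY ω) i]
  have := norm_integral_le_of_norm_le_const (μ := prob) (C := δ)
    (f := fun ω' => proxOracle G γ (zref ω) (fun s => ξ k s ω') t (z ω) i) hω
  simpa using this

theorem IsOracle.integral_mul_eq {X : Ω → ℝ} (hX : Measurable[past ξ k t] X)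
    (hint : Integrable
      (fun ω => proxOracle G γ (zref ω) (fun s => ξ k s ω) t (z ω) i * X ω) prob) :
    ∫ ω, proxOracle G γ (zref ω) (fun s => ξ k s ω) t (z ω) i * X ω ∂prob =
      ∫ ω, proxField f γ (zref ω) (z ω) i * X ω ∂prob := by
  have hind := h.indepFun_past ((hzref.prodMk hz).prodMk hX)
  have hle := h.past_le k t
  have hH : Measurable fun q : ((Joint d d' × Joint d d') × ℝ) × Ξ =>
      proxOracle G γ q.1.1.1 (fun _ : ℕ => q.2) 0 q.1.1.2 i * q.1.2 := by
    have h1 : Measurable fun q : ((Joint d d' × Joint d d') × ℝ) × Ξ =>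
        proxOracle G γ q.1.1.1 (fun _ : ℕ => q.2) 0 q.1.1.2 :=
      measurable_proxOracle
        (ξ := fun (q : ((Joint d d' × Joint d d') × ℝ) × Ξ) (_ : ℕ) => q.2) (t := 0)
        h.measurable_oracle γ measurable_fst.fst.fst measurable_fst.fst.snd measurable_snd
    exact ((measurable_coord i).comp h1).mul measurable_fst.snd
  have := integral_eq_integral_integral_of_indepFun
    (((hzref.mono hle le_rfl).prodMk (hz.mono hle le_rfl)).prodMk (hX.mono hle le_rfl))
    (h.measurable_sample k t) hind hH hint
  refine this.trans (integral_congr_ae (Eventually.of_forall fun ω => ?_))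
  simp only
  rw [integral_mul_const, ← h.integral_coord k t γ (zref ω) (hzY ω) i]
  rfl

end Step

end Oracle

/-! ### Moments of the stochastic error of an epoch. -/

/-- Orthogonality of martingale increments, with the variance bounded by the second moment: `h0`
removes the cross terms and `h1` gives `E (F - V)² = E V² - E F²`. -/
theorem integral_sq_sum_sub_le {Ω : Type*} {mΩ : MeasurableSpace Ω} {prob : Measure Ω}
    [IsProbabilityMeasure prob] {F V : ℕ → Ω → ℝ} {n : ℕ}
    (hF : ∀ t ∈ Finset.Icc 1 n, AEBounded prob (F t))
    (hV : ∀ t ∈ Finset.Icc 1 n, AEBounded prob (V t))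
    (h0 : ∀ t ∈ Finset.Icc 1 n,
      ∫ ω, (F t ω - V t ω) * ∑ s ∈ Finset.Icc 1 (t - 1), (F s ω - V s ω) ∂prob = 0)
    (h1 : ∀ t ∈ Finset.Icc 1 n, ∫ ω, (F t ω - V t ω) * F t ω ∂prob = 0) :
    ∫ ω, (∑ t ∈ Finset.Icc 1 n, (F t ω - V t ω)) ^ 2 ∂prob ≤
      ∫ ω, ∑ t ∈ Finset.Icc 1 n, V t ω ^ 2 ∂prob := by
  induction n with
  | zero => simp
  | succ n ih =>
    have hsub : ∀ t ∈ Finset.Icc 1 n, t ∈ Finset.Icc 1 (n + 1) :=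
      fun t ht => Finset.Icc_subset_Icc_right (Nat.le_succ n) ht
    have ih := ih (fun t ht => hF t (hsub t ht)) (fun t ht => hV t (hsub t ht))
      (fun t ht => h0 t (hsub t ht)) (fun t ht => h1 t (hsub t ht))
    have hlast : n + 1 ∈ Finset.Icc 1 (n + 1) := by simp
    have hF' := hF _ hlast
    have hV' := hV _ hlast
    have e1 := h0 _ hlast
    have e2 := h1 _ hlast
    rw [Nat.add_sub_cancel] at e1
    have hS : AEBounded prob fun ω => ∑ t ∈ Finset.Icc 1 n, (F t ω - V t ω) :=
      AEBounded.sum fun t ht => (hF t (hsub t ht)).sub (hV t (hsub t ht))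
    have hQ : AEBounded prob fun ω => ∑ t ∈ Finset.Icc 1 n, V t ω * V t ω :=
      AEBounded.sum fun t ht => (hV t (hsub t ht)).mul (hV t (hsub t ht))
    simp only [Finset.sum_Icc_succ_top (Nat.le_add_left 1 n)]
    set S : Ω → ℝ := fun ω => ∑ t ∈ Finset.Icc 1 n, (F t ω - V t ω) with hSdef
    have i5 := (hV'.mul hV').integrable
    have i4 := (hF'.mul hF').integrable
    have b1 := hS.mul hS
    have b2 := b1.add ((AEBounded.const 2).mul ((hF'.sub hV').mul hS))
    have b3 := b2.add ((AEBounded.const 2).mul ((hF'.sub hV').mul hF'))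
    have b4 := b3.add (hV'.mul hV')
    have hexp : ∀ ω, (∑ t ∈ Finset.Icc 1 n, (F t ω - V t ω) + (F (n + 1) ω - V (n + 1) ω)) ^ 2
        = S ω * S ω + 2 * ((F (n + 1) ω - V (n + 1) ω) * S ω)
          + 2 * ((F (n + 1) ω - V (n + 1) ω) * F (n + 1) ω)
          + V (n + 1) ω * V (n + 1) ω - F (n + 1) ω * F (n + 1) ω := fun ω => by
      simp only [hSdef]; ring
    simp only [hexp]
    rw [integral_sub b4.integrable i4, integral_add b3.integrable i5,
      integral_add b2.integrable ((AEBounded.const 2).mul ((hF'.sub hV').mul hF')).integrable,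
      integral_add b1.integrable ((AEBounded.const 2).mul ((hF'.sub hV').mul hS)).integrable,
      integral_const_mul, integral_const_mul, e1, e2]
    simp only [sq] at ih ⊢
    rw [integral_add hQ.integrable i5]
    have : 0 ≤ ∫ ω, F (n + 1) ω * F (n + 1) ω ∂prob :=
      integral_nonneg fun ω => mul_self_nonneg _
    linarith

section Run

variable {Ω Ξ : Type*} {mΩ : MeasurableSpace Ω} {prob : Measure Ω}
  {Y : Set (Vec d')} {f : Vec d → Vec d' → ℝ} {G : Joint d d' → Ξ → Joint d d'}
  {ξ : ℕ → ℕ → Ω → Ξ}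

/-- The iterates of an AdaGrad run on the proximal objective with the samples of epoch `k`, as
random variables. -/
def runIter (Y : Set (Vec d')) (G : Joint d d' → Ξ → Joint d d') (ξ : ℕ → ℕ → Ω → Ξ)
    (γ δ η : ℝ) (k : ℕ) (zref : Ω → Joint d d') (t : ℕ) (ω : Ω) : Joint d d' :=
  adaIter (feasible Y) (proxOracle G γ (zref ω) (fun s => ξ k s ω)) δ η (zref ω) t

/-- The stochastic gradients of such a run. -/
def runGrad (Y : Set (Vec d')) (G : Joint d d' → Ξ → Joint d d') (ξ : ℕ → ℕ → Ω → Ξ)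
    (γ δ η : ℝ) (k : ℕ) (zref : Ω → Joint d d') (t : ℕ) (ω : Ω) : Joint d d' :=
  adaGrad (feasible Y) (proxOracle G γ (zref ω) (fun s => ξ k s ω)) δ η (zref ω) t

theorem abs_coord_le_norm (z : Joint d d') (i : Fin d ⊕ Fin d') : |z i| ≤ ‖z‖ := by
  simpa using PiLp.norm_apply_le z i

theorem norm_le_of_abs_coord_le {δ : ℝ} {z : Joint d d'} (h : ∀ i, |z i| ≤ δ) :
    ‖z‖ ≤ √(∑ _i : Fin d ⊕ Fin d', δ ^ 2) := by
  refine Real.le_sqrt_of_sq_le ?_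
  rw [joint_norm_sq]
  refine Finset.sum_le_sum fun i _ => ?_
  exact sq_le_sq' (by linarith [(abs_le.1 (h i)).1]) (abs_le.1 (h i)).2

variable (hc : IsClosed Y) (hY : Convex ℝ Y) {γ δ η : ℝ} (hδ : 0 < δ) (k : ℕ)
  {zref : Ω → Joint d d'} (hmem : ∀ ω, zref ω ∈ feasible (d := d) Y)

section
include hc hY hδ hmem

theorem runIter_mem (t : ℕ) (ω : Ω) : runIter Y G ξ γ δ η k zref t ω ∈ feasible (d := d) Y :=
  (adaState_mem_and_growth (isClosed_feasible hc) (convex_feasible hY) hδ _ (hmem ω) _).1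

theorem norm_runIter_sub_le (hη : 0 < η) {t T : ℕ} (ht : t ∈ Finset.Icc 1 T) {ω : Ω}
    (hb : ∀ t ∈ Finset.Icc 1 T, ∀ i, |runGrad Y G ξ γ δ η k zref t ω i| ≤ δ) :
    ‖runIter Y G ξ γ δ η k zref t ω - zref ω‖ ≤
      η * (T * √(∑ _i : Fin d ⊕ Fin d', δ ^ 2)) / δ := by
  have h1 := adaState_dist_le (isClosed_feasible hc) (convex_feasible hY) hδ
    (proxOracle G γ (zref ω) (fun s => ξ k s ω)) (hmem ω) hη (t - 1)
  rw [le_div_iff₀ hδ, mul_comm]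
  refine h1.trans (mul_le_mul_of_nonneg_left ?_ hη.le)
  rw [adaState_gsum]
  have ht' := Finset.mem_Icc.1 ht
  have h2 := norm_sum_le_of_le (Finset.Icc 1 (t - 1))
    (f := fun s => runGrad Y G ξ γ δ η k zref s ω) (n := fun _ => √(∑ _i : Fin d ⊕ Fin d', δ ^ 2))
    fun s hs => norm_le_of_abs_coord_le
      (hb s (Finset.Icc_subset_Icc_right (by omega) hs))
  refine h2.trans ?_
  rw [Finset.sum_const, Nat.card_Icc, Nat.add_sub_cancel, nsmul_eq_mul]
  gcongr
  omega

end

variable [mΞ : MeasurableSpace Ξ] [IsProbabilityMeasure prob] (h : IsOracle prob Y f G ξ)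
  (hzref : Measurable[past ξ k 0] zref)

section
include h hc hY hδ hzref hmem

/-- The iterate at step `t` uses only samples with index at most `t - 1` of epoch `k`, besides those
of earlier epochs, so it is independent of `ξ k t`. -/
theorem measurable_runIter (t : ℕ) :
    Measurable[past ξ k t] (runIter Y G ξ γ δ η k zref t) := by
  have hzref' : Measurable[past ξ k t] zref := hzref.mono (past_mono (Nat.zero_le t)) le_rfl
  have hne : (feasible (d := d) Y).Nonempty := by
    obtain ⟨ω⟩ := prob.nonempty_of_neZero
    exact ⟨_, hmem ω⟩
  refine (measurable_adaState (isClosed_feasible hc) (convex_feasible hY) hne hδ hzref' (t - 1)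
    (fun s hs z hz => measurable_proxOracle h.measurable_oracle γ hzref' hz ?_)).1
  have := Finset.mem_Icc.1 hs
  exact measurable_past (Or.inr ⟨rfl, by omega⟩)

theorem measurable_runGrad (t : ℕ) :
    Measurable[past ξ k (t + 1)] (runGrad Y G ξ γ δ η k zref t) := by
  have h1 := (measurable_runIter hc hY (γ := γ) (η := η) hδ k hmem h hzref t).mono
    (past_mono (Nat.le_succ t)) le_rfl
  exact measurable_proxOracle (ξ := fun ω s => ξ k s ω) h.measurable_oracle γ
    (hzref.mono (past_mono (Nat.zero_le _)) le_rfl) h1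
    (measurable_past (Or.inr ⟨rfl, Nat.lt_succ_self t⟩))

theorem measurable_runField (t : ℕ) :
    Measurable[past ξ k t] fun ω => proxField f γ (zref ω) (runIter Y G ξ γ δ η k zref t ω) :=
  measurable_proxField h γ (hzref.mono (past_mono (Nat.zero_le _)) le_rfl)
    (measurable_runIter hc hY hδ k hmem h hzref t) (runIter_mem hc hY hδ k hmem t)

variable {T : ℕ}
  (hb : ∀ᵐ ω ∂prob, ∀ t ∈ Finset.Icc 1 T, ∀ i, |runGrad Y G ξ γ δ η k zref t ω i| ≤ δ)
include hb

theorem aebounded_runGrad {t : ℕ} (ht : t ∈ Finset.Icc 1 T) (i : Fin d ⊕ Fin d') :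
    AEBounded prob fun ω => runGrad Y G ξ γ δ η k zref t ω i := by
  refine ⟨(measurable_coord i).comp ((measurable_runGrad hc hY hδ k hmem h hzref t).mono
    (h.past_le _ _) le_rfl), δ, ?_⟩
  filter_upwards [hb] with ω hω using hω t ht i

theorem aebounded_runField {t : ℕ} (ht : t ∈ Finset.Icc 1 T) (i : Fin d ⊕ Fin d') :
    AEBounded prob fun ω => proxField f γ (zref ω) (runIter Y G ξ γ δ η k zref t ω) i := by
  refine ⟨(measurable_coord i).comp ((measurable_runField hc hY hδ k hmem h hzref t).mono
    (h.past_le _ _) le_rfl), δ, ?_⟩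
  refine h.abs_proxField_le γ (hzref.mono (past_mono (Nat.zero_le _)) le_rfl)
    (measurable_runIter hc hY hδ k hmem h hzref t) (runIter_mem hc hY hδ k hmem t) i ?_
  filter_upwards [hb] with ω hω using hω t ht i

theorem integral_error_mul_eq_zero {t : ℕ} (ht : t ∈ Finset.Icc 1 T) (i : Fin d ⊕ Fin d')
    {X : Ω → ℝ} (hX : Measurable[past ξ k t] X) (hXb : AEBounded prob X) :
    ∫ ω, (proxField f γ (zref ω) (runIter Y G ξ γ δ η k zref t ω) i
      - runGrad Y G ξ γ δ η k zref t ω i) * X ω ∂prob = 0 := by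
  have hV := (aebounded_runGrad hc hY hδ k hmem h hzref hb ht i).mul hXb
  have hF := (aebounded_runField hc hY hδ k hmem h hzref hb ht i).mul hXb
  simp only [sub_mul]
  rw [integral_sub hF.integrable hV.integrable, sub_eq_zero]
  exact (h.integral_mul_eq γ (hzref.mono (past_mono (Nat.zero_le _)) le_rfl)
    (measurable_runIter hc hY hδ k hmem h hzref t) (runIter_mem hc hY hδ k hmem t) i hX
    hV.integrable).symm

theorem integral_sq_sum_error_le (i : Fin d ⊕ Fin d') {n : ℕ} (hn : n ≤ T) :
    ∫ ω, (∑ t ∈ Finset.Icc 1 n, (proxField f γ (zref ω) (runIter Y G ξ γ δ η k zref t ω) i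
      - runGrad Y G ξ γ δ η k zref t ω i)) ^ 2 ∂prob ≤
    ∫ ω, ∑ t ∈ Finset.Icc 1 n, runGrad Y G ξ γ δ η k zref t ω i ^ 2 ∂prob := by
  have hmemT : ∀ t ∈ Finset.Icc 1 n, t ∈ Finset.Icc 1 T :=
    fun t ht => Finset.Icc_subset_Icc_right hn ht
  have hV := fun (t : ℕ) (ht : t ∈ Finset.Icc 1 n) =>
    aebounded_runGrad hc hY (γ := γ) (η := η) hδ k hmem h hzref hb (hmemT t ht) i
  have hF := fun (t : ℕ) (ht : t ∈ Finset.Icc 1 n) =>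
    aebounded_runField hc hY (γ := γ) (η := η) hδ k hmem h hzref hb (hmemT t ht) i
  refine integral_sq_sum_sub_le
    (F := fun t ω => proxField f γ (zref ω) (runIter Y G ξ γ δ η k zref t ω) i)
    (V := fun t ω => runGrad Y G ξ γ δ η k zref t ω i) hF hV (fun t ht => ?_) (fun t ht => ?_)
  · refine integral_error_mul_eq_zero hc hY hδ k hmem h hzref hb (hmemT t ht) i ?_
      (AEBounded.sum fun s hs => ?_)
    · refine Finset.measurable_fun_sum _ fun s hs => ?_
      have := Finset.mem_Icc.1 hs
      refine Measurable.sub ?_ ?_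
      · exact (measurable_coord i).comp ((measurable_runField hc hY hδ k hmem h hzref s).mono
          (past_mono (by omega)) le_rfl)
      · exact (measurable_coord i).comp ((measurable_runGrad hc hY hδ k hmem h hzref s).mono
          (past_mono (by omega)) le_rfl)
    · have h1 := Finset.mem_Icc.1 hs
      have h2 := Finset.mem_Icc.1 ht
      have hs' : s ∈ Finset.Icc 1 n := Finset.mem_Icc.2 ⟨h1.1, by omega⟩
      exact (hF s hs').sub (hV s hs')
  · exact integral_error_mul_eq_zero hc hY hδ k hmem h hzref hb (hmemT t ht) i
      ((measurable_coord i).comp (measurable_runField hc hY hδ k hmem h hzref t)) (hF t ht)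

/-- The regret contributes `ηB`, the inner products with `z t - zref` have mean zero, and the
squared error contributes `ηB/2`. -/
theorem epochNoise_integrable_and_le {μ A B : ℝ} (hγ : γ = μ / 4) (hη : 0 < η) (hA : 0 < A)
    (hmax : ∀ᵐ ω ∂prob, ∀ i, δ + adaNorm (feasible Y)
      (proxOracle G γ (zref ω) (fun s => ξ k s ω)) δ η (zref ω) T i ≤ A)
    (hsum : ∀ᵐ ω ∂prob, ∑ i, adaNorm (feasible Y)
      (proxOracle G γ (zref ω) (fun s => ξ k s ω)) δ η (zref ω) T i ≤ B) :
    Integrable (fun ω => epochNoise f μ η A B (zref ω) T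
      (fun t => runIter Y G ξ γ δ η k zref t ω) (fun t => runGrad Y G ξ γ δ η k zref t ω)) prob ∧
    ∫ ω, epochNoise f μ η A B (zref ω) T
      (fun t => runIter Y G ξ γ δ η k zref t ω) (fun t => runGrad Y G ξ γ δ η k zref t ω) ∂prob ≤
      3 / 2 * (η * B) / T := by
  subst hγ
  have hV := fun (t : ℕ) (ht : t ∈ Finset.Icc 1 T) (i : Fin d ⊕ Fin d') =>
    aebounded_runGrad hc hY (η := η) hδ k hmem h hzref hb ht i
  have hF := fun (t : ℕ) (ht : t ∈ Finset.Icc 1 T) (i : Fin d ⊕ Fin d') =>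
    aebounded_runField hc hY (η := η) hδ k hmem h hzref hb ht i
  have hzm : ∀ (t : ℕ) (i : Fin d ⊕ Fin d'), Measurable[past ξ k t] fun ω =>
      runIter Y G ξ (μ / 4) δ η k zref t ω i - zref ω i := fun t i =>
    ((measurable_coord i).comp (measurable_runIter hc hY hδ k hmem h hzref t)).sub
      ((measurable_coord i).comp (hzref.mono (past_mono (Nat.zero_le _)) le_rfl))
  have hz : ∀ t ∈ Finset.Icc 1 T, ∀ i : Fin d ⊕ Fin d', AEBounded prob fun ω =>
      runIter Y G ξ (μ / 4) δ η k zref t ω i - zref ω i := fun t ht i => by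
    refine ⟨(hzm t i).mono (h.past_le _ _) le_rfl,
      η * (T * √(∑ _i : Fin d ⊕ Fin d', δ ^ 2)) / δ, ?_⟩
    filter_upwards [hb] with ω hω
    exact (abs_coord_le_norm (runIter Y G ξ (μ / 4) δ η k zref t ω - zref ω) i).trans
      (norm_runIter_sub_le hc hY hδ k hmem hη ht hω)
  have hN : ∀ ω, epochNoise f μ η A B (zref ω) T
      (fun t => runIter Y G ξ (μ / 4) δ η k zref t ω)
      (fun t => runGrad Y G ξ (μ / 4) δ η k zref t ω) =
      (η * B + ∑ t ∈ Finset.Icc 1 T, ∑ i,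
        (proxField f (μ / 4) (zref ω) (runIter Y G ξ (μ / 4) δ η k zref t ω) i
          - runGrad Y G ξ (μ / 4) δ η k zref t ω i)
          * (runIter Y G ξ (μ / 4) δ η k zref t ω i - zref ω i)
        + η / (2 * A) * ∑ i, (∑ t ∈ Finset.Icc 1 T,
          (proxField f (μ / 4) (zref ω) (runIter Y G ξ (μ / 4) δ η k zref t ω) i
          - runGrad Y G ξ (μ / 4) δ η k zref t ω i)) ^ 2) * (1 / T) := fun ω => by
    unfold epochNoise
    simp only [joint_inner, joint_norm_sq, PiLp.sub_apply, WithLp.ofLp_sum, Finset.sum_apply,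
      WithLp.ofLp_sub, Pi.sub_apply, mul_one_div]
  simp only [hN]
  have hcross := fun (t : ℕ) (ht : t ∈ Finset.Icc 1 T) (i : Fin d ⊕ Fin d') =>
    ((hF t ht i).sub (hV t ht i)).mul (hz t ht i)
  have hcross' := fun (t : ℕ) (ht : t ∈ Finset.Icc 1 T) =>
    AEBounded.sum fun i (_ : i ∈ Finset.univ) => hcross t ht i
  have hcross'' := AEBounded.sum hcross'
  have hS := fun (i : Fin d ⊕ Fin d') =>
    AEBounded.sum fun t (ht : t ∈ Finset.Icc 1 T) => (hF t ht i).sub (hV t ht i)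
  have hSS := fun (i : Fin d ⊕ Fin d') => (hS i).mul (hS i)
  have hSS' := AEBounded.sum fun i (_ : i ∈ Finset.univ) => hSS i
  have hVV := fun (i : Fin d ⊕ Fin d') =>
    AEBounded.sum fun t (ht : t ∈ Finset.Icc 1 T) => (hV t ht i).mul (hV t ht i)
  have hsq := fun (i : Fin d ⊕ Fin d') =>
    integral_sq_sum_error_le hc hY (η := η) hδ k hmem h hzref hb i le_rfl
  simp only [sq] at hsq ⊢
  have hconst := AEBounded.const (prob := prob) (η * B)
  have hall := hconst.add hcross''
  have hquad := (AEBounded.const (prob := prob) (η / (2 * A))).mul hSS'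
  refine ⟨((hall.add hquad).mul (AEBounded.const (1 / (T : ℝ)))).integrable, ?_⟩
  rw [integral_mul_const, integral_add hall.integrable hquad.integrable,
    integral_add hconst.integrable hcross''.integrable, integral_const, integral_const_mul,
    integral_finsetSum _ (fun t ht => (hcross' t ht).integrable),
    integral_finsetSum _ (fun i _ => (hSS i).integrable)]
  have hzero : ∑ t ∈ Finset.Icc 1 T, ∫ ω, ∑ i,
        (proxField f (μ / 4) (zref ω) (runIter Y G ξ (μ / 4) δ η k zref t ω) i
          - runGrad Y G ξ (μ / 4) δ η k zref t ω i)
          * (runIter Y G ξ (μ / 4) δ η k zref t ω i - zref ω i) ∂prob = 0 := by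
    refine Finset.sum_eq_zero fun t ht => ?_
    rw [integral_finsetSum _ (fun i _ => (hcross t ht i).integrable)]
    exact Finset.sum_eq_zero fun i _ =>
      integral_error_mul_eq_zero hc hY hδ k hmem h hzref hb ht i (hzm t i) (hz t ht i)
  -- Each `E (∑ error)²` is at most the mean of the squared AdaGrad norm `s_i²`, and `∑ s_i² ≤ A ∑
  -- s_i ≤ A B` almost surely.
  have hle : ∑ i, ∫ ω, (∑ t ∈ Finset.Icc 1 T,
          (proxField f (μ / 4) (zref ω) (runIter Y G ξ (μ / 4) δ η k zref t ω) i
          - runGrad Y G ξ (μ / 4) δ η k zref t ω i)) * (∑ t ∈ Finset.Icc 1 T,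
          (proxField f (μ / 4) (zref ω) (runIter Y G ξ (μ / 4) δ η k zref t ω) i
          - runGrad Y G ξ (μ / 4) δ η k zref t ω i)) ∂prob ≤ A * B := by
    refine (Finset.sum_le_sum fun i _ => hsq i).trans ?_
    rw [← integral_finsetSum _ (fun i _ => (hVV i).integrable)]
    have hAB : ∫ _ω, A * B ∂prob = A * B := by simp
    rw [← hAB]
    refine integral_mono_ae (integrable_finsetSum _ fun i _ => (hVV i).integrable)
      (integrable_const _) ?_
    filter_upwards [hmax, hsum] with ω h1 h2
    refine le_trans ?_ (mul_le_mul_of_nonneg_left h2 hA.le)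
    rw [Finset.mul_sum]
    refine Finset.sum_le_sum fun i _ => ?_
    have h3 : ∑ t ∈ Finset.Icc 1 T, runGrad Y G ξ (μ / 4) δ η k zref t ω i
        * runGrad Y G ξ (μ / 4) δ η k zref t ω i = adaNorm (feasible Y)
      (proxOracle G (μ / 4) (zref ω) (fun s => ξ k s ω)) δ η (zref ω) T i ^ 2 := by
      simp only [← sq]
      exact (Real.sq_sqrt (Finset.sum_nonneg fun _ _ => sq_nonneg _)).symm
    have h4 : 0 ≤ adaNorm (feasible Y)
      (proxOracle G (μ / 4) (zref ω) (fun s => ξ k s ω)) δ η (zref ω) T i := Real.sqrt_nonneg _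
    rw [h3, sq]
    exact mul_le_mul_of_nonneg_right (by linarith [h1 i]) h4
  rw [hzero]
  have h5 := mul_le_mul_of_nonneg_left hle (by positivity : 0 ≤ η / (2 * A))
  have h6 : η / (2 * A) * (A * B) = 1 / 2 * (η * B) := by field_simp
  rw [← mul_one_div (3 / 2 * (η * B))]
  refine mul_le_mul_of_nonneg_right ?_ (by positivity)
  simp only [probReal_univ, one_smul, add_zero]
  linarith

end

end Run

/-! ### The recursion over the epochs and the expected gap. -/

/-- The solution of the recursion `U_{j+1} = 0.82 U_j + (960/191) N_{j+1}` driven by the errors of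
the epochs. -/
def noiseBound (c : ℝ) (N : ℕ → ℝ) : ℕ → ℝ
  | 0 => 2 * c + 960 / 191 * N 0
  | j + 1 => 41 / 50 * noiseBound c N j + 960 / 191 * N (j + 1)

/-- Substituting `hR` and then `hDQ` into `5/191` times `hstep` leaves the coefficients `130.6/191`
on `D j` and `503/191` on `Q j`, which are below `0.82` and `5 · 0.82`. -/
theorem potential_le_noiseBound {c : ℝ} {D Q R N : ℕ → ℝ} {K : ℕ} (hc : 0 ≤ c)
    (hD0 : D 0 ≤ c) (hR0 : R 0 ≤ c) (hD : ∀ j, 0 ≤ D j) (hQ : ∀ j, 0 ≤ Q j)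
    (hstep : ∀ j < K, 191 * Q j ≤ R j + 192 * N j)
    (hR : ∀ j, R (j + 1) ≤ 10 * Q j + 8 * (D j - D (j + 1)))
    (hDQ : ∀ j, D (j + 1) ≤ 3 / 5 * D j + 3 * Q j) :
    ∀ j < K, D j + 5 * Q j ≤ noiseBound c N j := by
  intro j
  induction j with
  | zero =>
    intro hj
    have := hstep 0 hj
    simp only [noiseBound]
    linarith
  | succ j ih =>
    intro hj
    have := ih (by omega)
    have h1 := hstep (j + 1) hj
    have h2 := hR j
    have h3 := hDQ j
    have h4 := hD (j + 1)
    have h5 := hD j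
    have h6 := hQ j
    simp only [noiseBound]
    linarith

/-- The contraction factor `0.82` is smaller than `e^{-1/16} ≥ 15/16`, so the potential inherits the
decay of the noise. -/
theorem noiseBound_integrable_and_le {Ω : Type*} {mΩ : MeasurableSpace Ω} {prob : Measure Ω}
    [IsProbabilityMeasure prob] {c E : ℝ} (hcE : c ≤ E) (hE : 0 ≤ E) {N : ℕ → Ω → ℝ} {K : ℕ}
    (hN : ∀ j < K, Integrable (N j) prob)
    (hNle : ∀ j < K, ∫ ω, N j ω ∂prob ≤ E / 256 * Real.exp (-1 / 16) ^ j) :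
    ∀ j < K, Integrable (fun ω => noiseBound c (fun i => N i ω) j) prob ∧
      ∫ ω, noiseBound c (fun i => N i ω) j ∂prob ≤ 3 * E * Real.exp (-1 / 16) ^ j := by
  intro j
  induction j with
  | zero =>
    intro hj
    have h1 := hN 0 hj
    have h2 := hNle 0 hj
    refine ⟨(integrable_const _).add (h1.const_mul _), ?_⟩
    simp only [noiseBound]
    rw [integral_add (integrable_const _) (h1.const_mul _), integral_const, integral_const_mul]
    simp only [probReal_univ, one_smul, pow_zero, mul_one] at h2 ⊢
    linarith
  | succ j ih =>
    intro hj
    obtain ⟨h3, h4⟩ := ih (by omega)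
    have h1 := hN (j + 1) hj
    have h2 := hNle (j + 1) hj
    refine ⟨(h3.const_mul _).add (h1.const_mul _), ?_⟩
    simp only [noiseBound]
    rw [integral_add (h3.const_mul _) (h1.const_mul _), integral_const_mul, integral_const_mul]
    have hq : 15 / 16 ≤ Real.exp (-1 / 16) := by
      have := Real.add_one_le_exp (-1 / 16 : ℝ)
      linarith
    rw [pow_succ] at h2 ⊢
    set q := Real.exp (-1 / 16)
    have hqj : 0 ≤ E * q ^ j := by positivity
    nlinarith [mul_le_mul_of_nonneg_left hq hqj]

/-- The infimum over uncountably many `x` is measurable because an infimum of continuous functions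
of `y` is upper semicontinuous. -/
theorem IsProblem.measurable_dualityGap {Y : Set (Vec d')} {f : Vec d → Vec d' → ℝ}
    {ℓ L ρ μ μx μy : ℝ} (h : IsProblem Y f ℓ L ρ μ μx μy) {Ω : Type*} {mΩ : MeasurableSpace Ω}
    {z : Ω → Joint d d'} (hz : Measurable z) (hzY : ∀ ω, z ω ∈ feasible (d := d) Y) :
    Measurable fun ω => dualityGap Y f (xPart (z ω)) (yPart (z ω)) := by
  have h1 : Measurable fun ω => primal Y f (xPart (z ω)) :=
    h.primal_diff.continuous.measurable.comp (continuous_xPart.measurable.comp hz)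
  have h2 : UpperSemicontinuous fun y : Y => ⨅ x, f x y := by
    refine upperSemicontinuous_ciInf (fun y => ?_) fun x => ?_
    · obtain ⟨xs, hxs, -⟩ := h.xside_PL y y.2
      exact ⟨f xs y, by rintro _ ⟨x, rfl⟩; exact hxs x⟩
    · have : ContinuousOn (f x) Y := fun y hy =>
        (h.diff_y x y hy).continuousAt.continuousWithinAt
      exact (continuousOn_iff_continuous_domRestrict.1 this).upperSemicontinuous
  have h3 : Measurable fun ω => (⟨yPart (z ω), hzY ω⟩ : Y) :=
    (continuous_yPart.measurable.comp hz).subtype_mk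
  exact h1.sub (h2.measurable.comp h3)

theorem stepSize_pos {η₀ : ℝ} (h : 0 < η₀) (k : ℕ) : 0 < stepSize η₀ k := by
  unfold stepSize; positivity

theorem mConst_pos (hn : 0 < d + d') : 0 < mConst d d' := by
  have : (0 : ℝ) < (d : ℝ) + d' := by exact_mod_cast hn
  unfold mConst; positivity

theorem budget_pos (hn : 0 < d + d') {μ μy η₀ : ℝ} (hμ : 0 < μ) (hμy : 0 < μy) (hη₀ : 0 < η₀)
    (k : ℕ) : 0 < budget d d' μ μy η₀ k := by
  have := mConst_pos hn
  have : 0 < min (μ / 8) μy := lt_min (by positivity) hμy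
  unfold budget; positivity

theorem mConst_div_budget (hn : 0 < d + d') {μ μy η₀ : ℝ} (hμ : 0 < μ) (hμy : 0 < μy)
    (hη₀ : 0 < η₀) (k : ℕ) :
    mConst d d' / budget d d' μ μy η₀ k = min (μ / 8) μy / 384 * stepSize η₀ k := by
  have := mConst_pos hn
  have : 0 < min (μ / 8) μy := lt_min (by positivity) hμy
  unfold budget stepSize
  rw [neg_div, Real.exp_neg]
  field_simp

/-- The left side is the bound `(3/2) η B / T` on the mean noise of epoch `j + 1`. It is quadratic
in the step size, which turns the rate `e^{-j/32}` into `e^{-j/16}`; and `256 = 384 · 2/3`. -/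
theorem stepSize_mul_inv_budget (hn : 0 < d + d') {μ μy η₀ : ℝ} (hμ : 0 < μ) (hμy : 0 < μy)
    (hη₀ : 0 < η₀) (j : ℕ) :
    3 / 2 * (stepSize η₀ (j + 1) * (1 / (mConst d d' * budget d d' μ μy η₀ (j + 1)))) =
      η₀ ^ 2 * min (μ / 8) μy * ((d : ℝ) + d') / 256 * Real.exp (-1 / 16) ^ j := by
  have hm := mConst_pos hn
  have hb := budget_pos hn hμ hμy hη₀ (j + 1)
  have hn' : (0 : ℝ) < (d : ℝ) + d' := by exact_mod_cast hn
  have h1 := mConst_div_budget hn hμ hμy hη₀ (j + 1)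
  have h2 : 1 / (mConst d d' * budget d d' μ μy η₀ (j + 1)) =
      (mConst d d' / budget d d' μ μy η₀ (j + 1)) * (1 / mConst d d' ^ 2) := by field_simp
  have h3 : 1 / mConst d d' ^ 2 = (d : ℝ) + d' := by
    unfold mConst
    rw [div_pow, Real.sq_sqrt hn'.le]
    simp
  have h4 : stepSize η₀ (j + 1) * stepSize η₀ (j + 1) = η₀ ^ 2 * Real.exp (-1 / 16) ^ j := by
    unfold stepSize
    rw [← Real.exp_nat_mul, mul_mul_mul_comm, ← Real.exp_add, sq]
    congr 2
    push_cast
    ring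
  rw [h2, h1, h3]
  linear_combination (3 / 2 * (min (μ / 8) μy / 384) * ((d : ℝ) + d')) * h4

section Main

variable {Ω Ξ : Type*} {mΩ : MeasurableSpace Ω} [mΞ : MeasurableSpace Ξ] {prob : Measure Ω}
  [IsProbabilityMeasure prob] {Y : Set (Vec d')} {f : Vec d → Vec d' → ℝ}
  {G : Joint d d' → Ξ → Joint d d'} {ξ : ℕ → ℕ → Ω → Ξ} {ℓ L ρ μ μx μy : ℝ}

theorem lengthRule_bounds (hn : 0 < d + d') (hμ : 0 < μ) (hμy : 0 < μy) {δ η₀ : ℝ} (hη₀ : 0 < η₀)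
    {k T : ℕ} {s : Fin d ⊕ Fin d' → ℝ}
    (h : budget d d' μ μy η₀ k * max ((δ + ⨆ i, s i) / mConst d d') (mConst d d' * ∑ i, s i) ≤ T) :
    (∀ i, δ + s i ≤ min (μ / 8) μy / 384 * (stepSize η₀ k * T)) ∧
      ∑ i, s i ≤ T * (1 / (mConst d d' * budget d d' μ μy η₀ k)) := by
  have hm := mConst_pos hn
  have hb := budget_pos hn hμ hμy hη₀ k
  have h1 := (mul_le_mul_of_nonneg_left (le_max_left _ _) hb.le).trans h
  have h2 := (mul_le_mul_of_nonneg_left (le_max_right _ _) hb.le).trans h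
  constructor
  · intro i
    rw [← mul_assoc, ← mConst_div_budget hn hμ hμy hη₀ k]
    have h3 : s i ≤ ⨆ i, s i := le_ciSup (Set.finite_range s).bddAbove i
    have h4 : δ + ⨆ i, s i ≤ mConst d d' / budget d d' μ μy η₀ k * T := by
      rw [div_mul_eq_mul_div, le_div_iff₀ hb]
      rw [mul_div_assoc', div_le_iff₀ hm] at h1
      linarith
    linarith
  · rw [mul_one_div, le_div_iff₀ (by positivity)]
    linarith

theorem reachesGap_of_lengthRule (h : IsProblem Y f ℓ L ρ μ μx μy) (hO : IsOracle prob Y f G ξ)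
    (hn : 0 < d + d') (hμ : 0 < μ) (hμx : 0 < μx) (hμy : 0 < μy) (hρ : ρ ≤ μ / 8)
    {δ η₀ ε₀ E ε : ℝ} (hδ : 0 < δ) (hη₀ : 0 < η₀) (hε₀ : 0 ≤ ε₀) (hε₀E : ε₀ ≤ E)
    (hE : η₀ ^ 2 * min (μ / 8) μy * ((d : ℝ) + d') = E) {x₀ : Vec d} {y₀ : Vec d'} (hy₀ : y₀ ∈ Y)
    (hgap : dualityGap Y f x₀ y₀ ≤ ε₀) {T : ℕ → ℕ} (hT : ∀ k, 1 ≤ T k) {J : ℕ}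
    (hJ : 21 * (μ / μx + 1) * (E * Real.exp (-1 / 16) ^ J) ≤ ε)
    (hb : GradBounded prob Y G (params μ δ η₀ T) (join x₀ y₀) ξ (J + 1))
    (hl : LengthRule prob Y G (params μ δ η₀ T) (join x₀ y₀) ξ (J + 1) (budget d d' μ μy η₀)) :
    ReachesGap prob Y f G (params μ δ η₀ T) (join x₀ y₀) ξ (J + 1) ε := by
  set p := params μ δ η₀ T with hp
  set z₀ : Joint d d' := join x₀ y₀ with hz₀def
  have hz₀ : z₀ ∈ feasible (d := d) Y := hy₀
  have hE0 : 0 ≤ E := hε₀.trans hε₀E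
  have hpδ : 0 < p.δ := hδ
  obtain ⟨xs, hxs, hPL⟩ := h.primal_PL
  set z : ℕ → Ω → Joint d d' := fun k ω => pes Y G p z₀ (fun k t => ξ k t ω) k with hz
  have hzmem : ∀ k ω, z k ω ∈ feasible (d := d) Y := fun k ω =>
    pes_mem h.closed h.convex (p := p) hT hpδ hz₀ _ k
  have hzmeas : ∀ j, Measurable[past ξ (j + 1) 0] (z j) := fun j =>
    measurable_pes h.closed h.convex hO.measurable_oracle hpδ hz₀ j fun i hi t =>
      measurable_past (Or.inl (by have := Finset.mem_Icc.1 hi; omega))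
  -- Deterministic bounds on the random AdaGrad norms: the two halves of the length rule give
  -- exactly `A` and `B`. The index `j` refers to epoch `j + 1`.
  let A : ℕ → ℝ := fun j => min (μ / 8) μy / 384 * (stepSize η₀ (j + 1) * T (j + 1))
  let B : ℕ → ℝ := fun j => T (j + 1) * (1 / (mConst d d' * budget d d' μ μy η₀ (j + 1)))
  have hA : ∀ j, 0 < A j := fun j => by
    have h1 := stepSize_pos hη₀ (j + 1)
    have h2 : 0 < min (μ / 8) μy := lt_min (by positivity) hμy
    have h3 : (0 : ℝ) < T (j + 1) := by exact_mod_cast hT (j + 1)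
    simp only [A]
    positivity
  let N : ℕ → Ω → ℝ := fun j ω => epochNoise f μ (stepSize η₀ (j + 1)) (A j) (B j) (z j ω)
    (T (j + 1)) (fun t => runIter Y G ξ (μ / 4) δ (stepSize η₀ (j + 1)) (j + 1) (z j) t ω)
    (fun t => runGrad Y G ξ (μ / 4) δ (stepSize η₀ (j + 1)) (j + 1) (z j) t ω)
  have hb' : ∀ᵐ ω ∂prob, ∀ j < J + 1, ∀ t ∈ Finset.Icc 1 (T (j + 1)), ∀ i,
      |runGrad Y G ξ (μ / 4) δ (stepSize η₀ (j + 1)) (j + 1) (z j) t ω i| ≤ δ := by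
    filter_upwards [hb] with ω hω j hj
    exact hω (j + 1) (Finset.mem_Icc.2 ⟨by omega, by omega⟩)
  have hl' : ∀ᵐ ω ∂prob, ∀ j < J + 1,
      (∀ i, δ + adaNorm (feasible Y) (proxOracle G (μ / 4) (z j ω) (fun s => ξ (j + 1) s ω)) δ
        (stepSize η₀ (j + 1)) (z j ω) (T (j + 1)) i ≤ A j) ∧
      ∑ i, adaNorm (feasible Y) (proxOracle G (μ / 4) (z j ω) (fun s => ξ (j + 1) s ω)) δ
        (stepSize η₀ (j + 1)) (z j ω) (T (j + 1)) i ≤ B j := by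
    filter_upwards [hl] with ω hω j hj
    exact lengthRule_bounds hn hμ hμy hη₀
      (hω (j + 1) (Finset.mem_Icc.2 ⟨by omega, by omega⟩))
  have hN : ∀ j < J + 1, Integrable (N j) prob ∧
      ∫ ω, N j ω ∂prob ≤ E / 256 * Real.exp (-1 / 16) ^ j := by
    intro j hj
    have h3 : (0 : ℝ) < T (j + 1) := by exact_mod_cast hT (j + 1)
    obtain ⟨h1, h2⟩ := epochNoise_integrable_and_le (f := f) h.closed h.convex hδ (j + 1) (hzmem j) hO
      (hzmeas j) (T := T (j + 1)) (hb'.mono fun ω hω => hω j hj) rfl (stepSize_pos hη₀ (j + 1))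
      (hA j) (hl'.mono fun ω hω => (hω j hj).1) (hl'.mono fun ω hω => (hω j hj).2)
    refine ⟨h1, h2.trans (le_of_eq ?_)⟩
    rw [← hE, ← stepSize_mul_inv_budget hn hμ hμy hη₀ j]
    simp only [B]
    field_simp
  obtain ⟨hUint, hUle⟩ := noiseBound_integrable_and_le (c := ε₀) hε₀E hE0 (fun j hj => (hN j hj).1)
    (fun j hj => (hN j hj).2) J (Nat.lt_succ_self J)
  have hpath : ∀ᵐ ω ∂prob, dualityGap Y f (xPart (z (J + 1) ω)) (yPart (z (J + 1) ω)) ≤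
      7 * (μ / μx + 1) * noiseBound ε₀ (fun i => N i ω) J := by
    filter_upwards [hb', hl'] with ω h1 h2
    have hrec := potential_le_noiseBound (c := ε₀) (K := J + 1)
      (D := fun j => primal Y f (xPart (z j ω)) - primal Y f xs)
      (Q := fun j => proxGap Y f μ (xPart (z j ω)) (xPart (z (j + 1) ω)) (yPart (z (j + 1) ω)))
      (R := fun j => proxGap Y f μ (xPart (z j ω)) (xPart (z j ω)) (yPart (z j ω)))
      (N := fun i => N i ω) hε₀
      ((h.primal_sub_le_dualityGap hμy x₀ xs hy₀).trans hgap)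
      ((h.proxGap_self_le hμ hρ x₀ hy₀).trans hgap)
      (fun j => sub_nonneg.2 (hxs _))
      (fun j => h.proxGap_nonneg hμ hμy hρ _ _ (hzmem (j + 1) ω))
      (fun j hj => h.epoch_bound hμ hμy hρ hδ (stepSize_pos hη₀ (j + 1)) (hA j) _ (hzmem j ω)
        (hT (j + 1)) (h1 j hj) (h2 j hj).1 (h2 j hj).2 rfl)
      (fun j => by
        have := h.proxGap_recenter_le hμ hμy hρ (xPart (z j ω)) (xPart (z (j + 1) ω))
          (hzmem (j + 1) ω)
        linarith)
      (fun j => h.primal_sub_le hμ hμy hρ _ _ (hzmem (j + 1) ω) hxs hPL)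
      J (Nat.lt_succ_self J)
    -- The gap at the output of epoch `J + 1` is controlled by the potential at index `J`, hence the
    -- `J + 1` epochs.
    refine (h.dualityGap_le hμ hμy hρ (xPart (z J ω)) (xPart (z (J + 1) ω)) (hzmem (J + 1) ω) hμx
      hxs).trans ?_
    have h3 := h.proxGap_nonneg hμ hμy hρ (xPart (z J ω)) (xPart (z (J + 1) ω)) (hzmem (J + 1) ω)
    have h4 : 0 < μ / μx + 1 := by positivity
    refine mul_le_mul_of_nonneg_left ?_ (by positivity)
    linarith
  have hUint' := hUint.const_mul (7 * (μ / μx + 1))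
  have hgmeas : Measurable fun ω => dualityGap Y f (xPart (z (J + 1) ω)) (yPart (z (J + 1) ω)) :=
    h.measurable_dualityGap ((hzmeas (J + 1)).mono (hO.past_le _ _) le_rfl) (hzmem (J + 1))
  have hgnn : ∀ ω, 0 ≤ dualityGap Y f (xPart (z (J + 1) ω)) (yPart (z (J + 1) ω)) := fun ω => by
    have := h.primal_sub_le_dualityGap hμy (xPart (z (J + 1) ω)) (xPart (z (J + 1) ω))
      (hzmem (J + 1) ω)
    linarith
  have hgint : Integrable (fun ω => dualityGap Y f (xPart (z (J + 1) ω)) (yPart (z (J + 1) ω)))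
      prob := by
    refine hUint'.mono' hgmeas.aestronglyMeasurable ?_
    filter_upwards [hpath] with ω hω
    rwa [Real.norm_of_nonneg (hgnn ω)]
  refine ⟨hgint, (integral_mono_ae hgint hUint' hpath).trans ?_⟩
  rw [integral_const_mul]
  have h4 : 0 < μ / μx + 1 := by positivity
  have h5 := mul_le_mul_of_nonneg_left hUle (by positivity : 0 ≤ 7 * (μ / μx + 1))
  linarith

end Main

/-! ### Epoch lengths, iteration count and choice of parameters. -/

theorem sum_pow_le_of_ratio {r : ℝ} (hr : 33 / 32 ≤ r) (J : ℕ) :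
    ∑ j ∈ Finset.range (J + 1), r ^ j ≤ 33 * r ^ J := by
  induction J with
  | zero => norm_num
  | succ J ih =>
    rw [Finset.sum_range_succ, pow_succ]
    nlinarith [pow_nonneg (by linarith : 0 ≤ r) J]

theorem sqrt_mul_mConst (hn : 0 < d + d') : √((d : ℝ) + d') * mConst d d' = 1 := by
  have : (0 : ℝ) < (d : ℝ) + d' := by exact_mod_cast hn
  have : 0 < √((d : ℝ) + d') := Real.sqrt_pos.2 this
  unfold mConst
  field_simp

theorem epochLength_base_eq (hn : 0 < d + d') (μ μy δ η₀ : ℝ) (j : ℕ) :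
    2 * √((d : ℝ) + d') * δ * budget d d' μ μy η₀ (j + 1) =
      768 * δ / (η₀ * min (μ / 8) μy) * Real.exp (1 / 32) ^ j := by
  have h1 := sqrt_mul_mConst hn
  have h2 : Real.exp ((((j + 1 : ℕ) : ℝ) - 1) / 32) = Real.exp (1 / 32) ^ j := by
    rw [← Real.exp_nat_mul]
    push_cast
    ring_nf
  unfold budget
  rw [h2]
  linear_combination (768 * δ / (η₀ * min (μ / 8) μy) * Real.exp (1 / 32) ^ j) * h1

theorem sum_epochLength_le (hn : 0 < d + d') {μ μy δ α η₀ : ℝ} (hμ : 0 < μ) (hμy : 0 < μy)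
    (hδ : 0 < δ) (hα : 0 < α) (hα' : α ≤ 1 / 2) (hη₀ : 0 < η₀) (J : ℕ) :
    ∑ k ∈ Finset.Icc 1 (J + 1), (epochLength d d' μ μy δ α η₀ k : ℝ) ≤
      33 * ((768 * δ / (η₀ * min (μ / 8) μy)) ^ 2 * Real.exp (1 / 16) ^ J) ^ (1 / (2 * (1 - α)))
        + (J + 1) := by
  have hl : 0 < min (μ / 8) μy := lt_min (by positivity) hμy
  set a := 768 * δ / (η₀ * min (μ / 8) μy) with ha
  have ha0 : 0 < a := by positivity
  have hα1 : 0 < 1 - α := by linarith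
  set p := 1 / (1 - α) with hp
  have hp1 : 1 ≤ p := by rw [hp, le_div_iff₀ hα1]; linarith
  set r := Real.exp (1 / 32) ^ p with hr
  have hr1 : 33 / 32 ≤ r := by
    have h1 : 33 / 32 ≤ Real.exp (1 / 32) := by
      have := Real.add_one_le_exp (1 / 32 : ℝ)
      linarith
    exact h1.trans (Real.self_le_rpow_of_one_le (by linarith) hp1)
  have hterm : ∀ j : ℕ, (epochLength d d' μ μy δ α η₀ (j + 1) : ℝ) ≤ a ^ p * r ^ j + 1 := by
    intro j
    unfold epochLength
    rw [epochLength_base_eq hn]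
    have h0 : 0 ≤ (a * Real.exp (1 / 32) ^ j) ^ p := by positivity
    have h1 := (Nat.ceil_lt_add_one h0).le
    have h2 : (a * Real.exp (1 / 32) ^ j) ^ p = a ^ p * r ^ j := by
      rw [Real.mul_rpow ha0.le (by positivity), hr, ← Real.rpow_natCast, ← Real.rpow_natCast,
        ← Real.rpow_mul (by positivity), ← Real.rpow_mul (by positivity), mul_comm p]
    rw [h2] at h1
    rwa [h2]
  have hsum : ∑ k ∈ Finset.Icc 1 (J + 1), (epochLength d d' μ μy δ α η₀ k : ℝ)
      = ∑ j ∈ Finset.range (J + 1), (epochLength d d' μ μy δ α η₀ (j + 1) : ℝ) := by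
    rw [Finset.range_eq_Ico, Finset.sum_Ico_add' (fun k => (epochLength d d' μ μy δ α η₀ k : ℝ))]
    rfl
  rw [hsum]
  refine (Finset.sum_le_sum fun j _ => hterm j).trans ?_
  rw [Finset.sum_add_distrib, ← Finset.mul_sum]
  have h1 := mul_le_mul_of_nonneg_left (sum_pow_le_of_ratio hr1 J) (by positivity : 0 ≤ a ^ p)
  have h2 : a ^ p * r ^ J = (a ^ 2 * Real.exp (1 / 16) ^ J) ^ (1 / (2 * (1 - α))) := by
    have e1 : a ^ 2 * Real.exp (1 / 16) ^ J = (a * Real.exp (1 / 32) ^ J) ^ (2 : ℝ) := by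
      have e0 : Real.exp (1 / 32) ^ 2 = Real.exp (1 / 16) := by
        rw [← Real.exp_nat_mul]
        norm_num
      rw [Real.rpow_two, mul_pow, ← pow_mul, mul_comm J 2, pow_mul, e0]
    have e2 : 2 * (1 / (2 * (1 - α))) = p := by rw [hp]; field_simp
    rw [e1, ← Real.rpow_mul (by positivity), e2, Real.mul_rpow ha0.le (by positivity), hr,
      ← Real.rpow_natCast, ← Real.rpow_natCast, ← Real.rpow_mul (by positivity),
      ← Real.rpow_mul (by positivity), mul_comm p]
  rw [← h2]
  simp only [Finset.sum_const, Finset.card_range, nsmul_eq_mul, mul_one]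
  push_cast
  linarith

theorem one_le_epochLength (hn : 0 < d + d') {μ μy δ α η₀ : ℝ} (hμ : 0 < μ) (hμy : 0 < μy)
    (hδ : 0 < δ) (hη₀ : 0 < η₀) (k : ℕ) : 1 ≤ epochLength d d' μ μy δ α η₀ k := by
  have hb := budget_pos hn hμ hμy hη₀ k
  have hn' : (0 : ℝ) < (d : ℝ) + d' := by exact_mod_cast hn
  refine Nat.one_le_ceil_iff.2 (Real.rpow_pos_of_pos ?_ _)
  have : 0 < √((d : ℝ) + d') := Real.sqrt_pos.2 hn'
  positivity

/-- The growth condition implies the length rule. Both entries of the maximum are at most `2√(d+d')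
δ T^α`, where the first uses `1 ≤ T^α`, and the length was chosen so that `2√(d+d') δ M ≤ T^(1-α)`.
-/
theorem budget_mul_max_le_epochLength (hn : 0 < d + d') {μ μy δ α η₀ : ℝ} (hμ : 0 < μ)
    (hμy : 0 < μy) (hδ : 0 < δ) (hα : 0 < α) (hα' : α ≤ 1 / 2) (hη₀ : 0 < η₀) (k : ℕ)
    {s : Fin d ⊕ Fin d' → ℝ}
    (hs : ∀ i, s i ≤ δ * (epochLength d d' μ μy δ α η₀ k : ℝ) ^ α) :
    budget d d' μ μy η₀ k * max ((δ + ⨆ i, s i) / mConst d d') (mConst d d' * ∑ i, s i) ≤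
      epochLength d d' μ μy δ α η₀ k := by
  have hb := budget_pos hn hμ hμy hη₀ k
  have hm := mConst_pos hn
  have hn' : (0 : ℝ) < (d : ℝ) + d' := by exact_mod_cast hn
  have hsq : 0 < √((d : ℝ) + d') := Real.sqrt_pos.2 hn'
  have hsm := sqrt_mul_mConst hn
  have hT1 : (1 : ℝ) ≤ epochLength d d' μ μy δ α η₀ k := by
    exact_mod_cast one_le_epochLength hn hμ hμy hδ hη₀ k
  have hTge : (2 * √((d : ℝ) + d') * δ * budget d d' μ μy η₀ k) ^ (1 / (1 - α)) ≤
      epochLength d d' μ μy δ α η₀ k := Nat.le_ceil _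
  set T : ℝ := ((epochLength d d' μ μy δ α η₀ k : ℕ) : ℝ)
  have hα1 : 0 < 1 - α := by linarith
  have hTα : 1 ≤ T ^ α := Real.one_le_rpow hT1 hα.le
  have h1 : 2 * √((d : ℝ) + d') * δ * budget d d' μ μy η₀ k ≤ T ^ (1 - α) := by
    have h2 := Real.rpow_le_rpow (by positivity) hTge hα1.le
    rwa [← Real.rpow_mul (by positivity), one_div_mul_cancel hα1.ne', Real.rpow_one] at h2
  have h2 : 2 * √((d : ℝ) + d') * δ * budget d d' μ μy η₀ k * T ^ α ≤ T := by
    have h3 := mul_le_mul_of_nonneg_right h1 (by positivity : 0 ≤ T ^ α)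
    rwa [← Real.rpow_add (by positivity), sub_add_cancel, Real.rpow_one] at h3
  have hmax : max ((δ + ⨆ i, s i) / mConst d d') (mConst d d' * ∑ i, s i) ≤
      2 * √((d : ℝ) + d') * δ * T ^ α := by
    refine max_le ?_ ?_
    · have hne : Nonempty (Fin d ⊕ Fin d') := by
        rcases (by omega : 0 < d ∨ 0 < d') with h | h
        · exact ⟨Sum.inl ⟨0, h⟩⟩
        · exact ⟨Sum.inr ⟨0, h⟩⟩
      have h3 : ⨆ i, s i ≤ δ * T ^ α := ciSup_le hs
      rw [div_le_iff₀ hm]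
      have h4 : 2 * √((d : ℝ) + d') * δ * T ^ α * mConst d d' = 2 * δ * T ^ α := by
        linear_combination (2 * δ * T ^ α) * hsm
      rw [h4]
      nlinarith
    · have h3 : ∑ i, s i ≤ ((d : ℝ) + d') * (δ * T ^ α) := by
        refine (Finset.sum_le_sum fun i _ => hs i).trans (le_of_eq ?_)
        simp [add_mul]
      refine (mul_le_mul_of_nonneg_left h3 hm.le).trans ?_
      have h4 : ((d : ℝ) + d') = √((d : ℝ) + d') * √((d : ℝ) + d') :=
        (Real.mul_self_sqrt hn'.le).symm
      have h5 : mConst d d' * (((d : ℝ) + d') * (δ * T ^ α)) = √((d : ℝ) + d') * (δ * T ^ α) := by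
        conv_lhs => rw [h4]
        linear_combination (√((d : ℝ) + d') * (δ * T ^ α)) * hsm
      rw [h5]
      have : 0 ≤ √((d : ℝ) + d') * (δ * T ^ α) := by positivity
      linarith
  refine (mul_le_mul_of_nonneg_left hmax hb.le).trans ?_
  linarith

theorem exists_params (hn : 0 < d + d') {μ μx μy δ α ε₀ ε : ℝ} (hμ : 0 < μ) (hμx : 0 < μx)
    (hμy : 0 < μy) (hδ : 0 < δ) (hα : 0 < α) (hα' : α ≤ 1 / 2) (hε₀ : 0 ≤ ε₀) (hε : 0 < ε) :
    ∃ (η₀ E : ℝ) (J : ℕ), 0 < η₀ ∧ ε₀ ≤ E ∧ η₀ ^ 2 * min (μ / 8) μy * ((d : ℝ) + d') = E ∧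
      21 * (μ / μx + 1) * (E * Real.exp (-1 / 16) ^ J) ≤ ε ∧
      ∑ k ∈ Finset.Icc 1 (J + 1), (epochLength d d' μ μy δ α η₀ k : ℝ) ≤
        (33 * (768 ^ 2 * 336) + 400) * (1 + Real.log (1 + (μ / μx + 1) * (ε₀ / ε))) *
          max 1 ((μ / μx + 1) *
            (δ ^ 2 * ((d : ℝ) + d') / (min μ μy * ε)) ^ (1 / (2 * (1 - α)))) := by
  have hn' : (0 : ℝ) < (d : ℝ) + d' := by exact_mod_cast hn
  have hl : 0 < min (μ / 8) μy := lt_min (by positivity) hμy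
  set l := min (μ / 8) μy
  have hll : min μ μy / 8 ≤ l := by
    refine le_min ?_ ?_
    · linarith [min_le_left μ μy]
    · linarith [min_le_right μ μy]
  have hmm : 0 < min μ μy := lt_min hμ hμy
  have hB : 1 ≤ μ / μx + 1 := by linarith [div_pos hμ hμx]
  set B := μ / μx + 1
  have hB0 : 0 < B := by linarith
  set W := 1 + B * (ε₀ / ε) with hW
  have hW1 : 1 ≤ W := by
    have : 0 ≤ B * (ε₀ / ε) := by positivity
    linarith
  -- The summand `ε / B` keeps `η₀` positive when `ε₀ = 0` and gives the clean identity `B * E = W *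
  -- ε`.
  set E := ε₀ + ε / B with hEdef
  have hE0 : 0 < E := by positivity
  have hWE : B * E = W * ε := by rw [hW, hEdef]; field_simp; ring
  have hη : 0 < √(E / (l * ((d : ℝ) + d'))) := Real.sqrt_pos.2 (by positivity)
  have hη2 : √(E / (l * ((d : ℝ) + d'))) ^ 2 = E / (l * ((d : ℝ) + d')) :=
    Real.sq_sqrt (by positivity)
  set η₀ := √(E / (l * ((d : ℝ) + d')))
  have hlog : 0 ≤ Real.log (21 * W) := Real.log_nonneg (by linarith)
  -- Chosen so that `e^{J/16} ≥ 21 W`, which brings the final bound `21 B E e^{-J/16}` down to `ε`.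
  set J := ⌈16 * Real.log (21 * W)⌉₊
  have hJ1 : 16 * Real.log (21 * W) ≤ J := Nat.le_ceil _
  have hJ2 : (J : ℝ) ≤ 16 * Real.log (21 * W) + 1 := (Nat.ceil_lt_add_one (by positivity)).le
  have hlogW : 0 ≤ Real.log W := Real.log_nonneg hW1
  refine ⟨η₀, E, J, hη, le_add_of_nonneg_right (by positivity), ?_, ?_, ?_⟩
  · rw [hη2]; field_simp
  · have h1 : 21 * W ≤ Real.exp (J / 16) := by
      rw [← Real.exp_log (by positivity : 0 < 21 * W)]
      exact Real.exp_le_exp.2 (by linarith)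
    have h2 : Real.exp (-1 / 16) ^ J = (Real.exp (J / 16))⁻¹ := by
      rw [← Real.exp_nat_mul, ← Real.exp_neg]
      ring_nf
    rw [h2]
    have h3 : 21 * B * (E * (Real.exp (J / 16))⁻¹) = 21 * W * ε / Real.exp (J / 16) := by
      rw [div_eq_mul_inv, mul_assoc 21 W ε, ← hWE]
      ring
    rw [h3, div_le_iff₀ (Real.exp_pos _)]
    nlinarith
  · refine (sum_epochLength_le hn hμ hμy hδ hα hα' hη J).trans ?_
    set X := δ ^ 2 * ((d : ℝ) + d') / (min μ μy * ε) with hX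
    have hX0 : 0 < X := by positivity
    set s := 1 / (2 * (1 - α)) with hs
    have hs0 : 0 < s := by
      have : 0 < 1 - α := by linarith
      positivity
    have hs1 : s ≤ 1 := by
      rw [hs, div_le_one (by linarith)]
      linarith
    -- Rounding `J` up costs a factor `e^{1/16} ≤ 2`. With the later factor `8` from `min μ μy / 8 ≤
    -- l`, this gives `336 = 8 · 42`.
    have hexp : Real.exp (1 / 16) ^ J ≤ 42 * W := by
      have h1 : Real.exp (1 / 16) ^ J = Real.exp (J / 16) := by
        rw [← Real.exp_nat_mul]
        ring_nf
      have h2 : Real.exp (J / 16) ≤ Real.exp (Real.log (21 * W) + 1 / 16) :=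
        Real.exp_le_exp.2 (by linarith)
      have h3 : Real.exp (1 / 16 : ℝ) ≤ 2 := by
        have := Real.exp_bound_div_one_sub_of_interval (x := 1 / 16) (by norm_num) (by norm_num)
        norm_num at this ⊢
        linarith
      rw [Real.exp_add, Real.exp_log (by positivity)] at h2
      rw [h1]
      nlinarith
    have hbase : (768 * δ / (η₀ * l)) ^ 2 * Real.exp (1 / 16) ^ J ≤ (768 ^ 2 * 336 * B) * X := by
      have h1 : (768 * δ / (η₀ * l)) ^ 2 = 768 ^ 2 * δ ^ 2 * ((d : ℝ) + d') / (l * E) := by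
        rw [div_pow, mul_pow, mul_pow, hη2]
        field_simp
      have h2 : (768 * δ / (η₀ * l)) ^ 2 * Real.exp (1 / 16) ^ J ≤
          768 ^ 2 * δ ^ 2 * ((d : ℝ) + d') / (l * E) * (42 * W) := by
        rw [h1]
        exact mul_le_mul_of_nonneg_left hexp (by positivity)
      have h3 : 768 ^ 2 * δ ^ 2 * ((d : ℝ) + d') / (l * E) * (42 * W) =
          768 ^ 2 * 42 * B * (δ ^ 2 * ((d : ℝ) + d') / (l * ε)) := by
        have : W = B * E / ε := by rw [hWE]; field_simp
        rw [this]
        field_simp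
      have h4 : δ ^ 2 * ((d : ℝ) + d') / (l * ε) ≤ 8 * X := by
        have : 8 * X = δ ^ 2 * ((d : ℝ) + d') / (min μ μy / 8 * ε) := by
          rw [hX]; field_simp
        rw [this]
        gcongr
      rw [h3] at h2
      refine h2.trans ?_
      have := mul_le_mul_of_nonneg_left h4 (by positivity : 0 ≤ 768 ^ 2 * 42 * B)
      linarith
    have hpow : ((768 * δ / (η₀ * l)) ^ 2 * Real.exp (1 / 16) ^ J) ^ s ≤
        768 ^ 2 * 336 * (B * X ^ s) := by
      refine (Real.rpow_le_rpow (by positivity) hbase hs0.le).trans ?_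
      rw [Real.mul_rpow (by positivity) hX0.le, ← mul_assoc]
      refine mul_le_mul_of_nonneg_right ?_ (by positivity)
      -- Since `s ≤ 1` and the prefactor is at least `1`, its power is at most itself; this is why
      -- `μ/μx + 1` appears outside the power.
      exact Real.rpow_le_self_of_one_le (by nlinarith) hs1
    have hJ3 : (J : ℝ) + 1 ≤ 400 * (1 + Real.log W) := by
      rw [Real.log_mul (by norm_num) (by positivity)] at hJ2
      have := Real.log_le_sub_one_of_pos (by norm_num : (0 : ℝ) < 21)
      linarith
    have hmax1 : 1 ≤ max 1 (B * X ^ s) := le_max_left _ _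
    have hmax2 : B * X ^ s ≤ max 1 (B * X ^ s) := le_max_right _ _
    set m := max 1 (B * X ^ s)
    have hm1 : m ≤ (1 + Real.log W) * m := le_mul_of_one_le_left (by linarith) (by linarith)
    have hm2 : 1 + Real.log W ≤ (1 + Real.log W) * m :=
      le_mul_of_one_le_right (by linarith) hmax1
    linarith

theorem reachesGap_of_dim_eq_zero {Ω Ξ : Type*} {mΩ : MeasurableSpace Ω} {prob : Measure Ω}
    [IsProbabilityMeasure prob] {Y : Set (Vec d')} {f : Vec d → Vec d' → ℝ}
    {G : Joint d d' → Ξ → Joint d d'} {ξ : ℕ → ℕ → Ω → Ξ} {ℓ L ρ μ μx μy : ℝ}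
    (h : IsProblem Y f ℓ L ρ μ μx μy) (hd : d = 0) (hd' : d' = 0) (hμy : 0 < μy) {x₀ : Vec d}
    {y₀ : Vec d'} (hy₀ : y₀ ∈ Y) {ε : ℝ} (hε : 0 < ε) (p : Params) :
    ReachesGap prob Y f G p (join x₀ y₀) ξ 0 ε := by
  subst hd hd'
  have hgap : dualityGap Y f x₀ y₀ = 0 := by
    obtain ⟨v, -, hP, -⟩ := h.exists_max hμy ⟨y₀, hy₀⟩ x₀
    have : Set.range (fun x' => f x' y₀) = {f x₀ y₀} := by
      ext r
      simp only [Set.mem_range, Set.mem_singleton_iff]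
      exact ⟨fun ⟨x, hx⟩ => by rw [← hx, Subsingleton.elim x x₀], fun hr => ⟨x₀, hr.symm⟩⟩
    rw [dualityGap, hP, this, csInf_singleton, Subsingleton.elim v y₀, sub_self]
  refine ⟨show Integrable (fun _ => dualityGap Y f x₀ y₀) prob from integrable_const _, ?_⟩
  change ∫ _ω, dualityGap Y f x₀ y₀ ∂prob ≤ ε
  rw [hgap]
  simpa using hε.le

end PesAdaGrad

end

theorem mainTheorem12 :
    ∃ C : ℝ, 0 < C ∧
      ∀ (d d' : ℕ) (μ μx μy δ α ε₀ ε : ℝ), 0 < μ → 0 < μx → 0 < μy → 0 < δ →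
        0 < α → α ≤ 1 / 2 → 0 ≤ ε₀ → 0 < ε →
      ∃ (η₀ : ℝ) (K : ℕ), 0 < η₀ ∧
        (∑ k ∈ Finset.Icc 1 K, (PesAdaGrad.epochLength d d' μ μy δ α η₀ k : ℝ)) ≤
          C * (1 + Real.log (1 + (μ / μx + 1) * (ε₀ / ε))) *
            max 1 ((μ / μx + 1) *
              (δ ^ 2 * ((d : ℝ) + d') / (min μ μy * ε)) ^ (1 / (2 * (1 - α)))) ∧
        ∀ (ℓ L ρ : ℝ) (Y : Set (PesAdaGrad.Vec d'))
          (f : PesAdaGrad.Vec d → PesAdaGrad.Vec d' → ℝ)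
          (x₀ : PesAdaGrad.Vec d) (y₀ : PesAdaGrad.Vec d')
          (Ω Ξ : Type*) [MeasurableSpace Ω] [MeasurableSpace Ξ]
          (prob : Measure Ω) [IsProbabilityMeasure prob]
          (G : PesAdaGrad.Joint d d' → Ξ → PesAdaGrad.Joint d d') (ξ : ℕ → ℕ → Ω → Ξ),
          0 < ρ → ρ ≤ ℓ → ρ ≤ μ / 8 →
          PesAdaGrad.IsProblem Y f ℓ L ρ μ μx μy →
          y₀ ∈ Y → PesAdaGrad.dualityGap Y f x₀ y₀ ≤ ε₀ →
          PesAdaGrad.IsOracle prob Y f G ξ →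
          (∀ p : PesAdaGrad.Params,
            p = PesAdaGrad.params μ δ η₀ (PesAdaGrad.epochLength d d' μ μy δ α η₀) →
            PesAdaGrad.GradBounded prob Y G p (PesAdaGrad.join x₀ y₀) ξ K →
            PesAdaGrad.GradGrowth prob Y G p (PesAdaGrad.join x₀ y₀) ξ K α →
            PesAdaGrad.ReachesGap prob Y f G p (PesAdaGrad.join x₀ y₀) ξ K ε) ∧
          (∀ (T : ℕ → ℕ) (p : PesAdaGrad.Params), (∀ k, 1 ≤ T k) →
            p = PesAdaGrad.params μ δ η₀ T →
            PesAdaGrad.GradBounded prob Y G p (PesAdaGrad.join x₀ y₀) ξ K →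
            PesAdaGrad.LengthRule prob Y G p (PesAdaGrad.join x₀ y₀) ξ K
              (PesAdaGrad.budget d d' μ μy η₀) →
            PesAdaGrad.ReachesGap prob Y f G p (PesAdaGrad.join x₀ y₀) ξ K ε) := by
  refine ⟨33 * (768 ^ 2 * 336) + 400, by norm_num, ?_⟩
  intro d d' μ μx μy δ α ε₀ ε hμ hμx hμy hδ hα hα' hε₀ hε
  rcases Nat.eq_zero_or_pos (d + d') with hn | hn
  · have hd : d = 0 := by omega
    have hd' : d' = 0 := by omega
    -- In dimension zero `mConst` is `1 / 0 = 0` and the rules degenerate, but the gap is already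
    -- `0`, so no epoch is run.
    refine ⟨1, 0, one_pos, ?_, ?_⟩
    · have hlog : 0 ≤ Real.log (1 + (μ / μx + 1) * (ε₀ / ε)) :=
        Real.log_nonneg (le_add_of_nonneg_right (by positivity))
      rw [Finset.Icc_eq_empty (by omega), Finset.sum_empty]
      positivity
    · intro ℓ L ρ Y f x₀ y₀ Ω Ξ _ _ prob _ G ξ _ _ _ h hy₀ _ _
      exact ⟨fun p _ _ _ => PesAdaGrad.reachesGap_of_dim_eq_zero h hd hd' hμy hy₀ hε p,
        fun T p _ _ _ _ => PesAdaGrad.reachesGap_of_dim_eq_zero h hd hd' hμy hy₀ hε p⟩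
  · obtain ⟨η₀, E, J, hη₀, hε₀E, hE, hJ, hsum⟩ :=
      PesAdaGrad.exists_params hn hμ hμx hμy hδ hα hα' hε₀ hε
    refine ⟨η₀, J + 1, hη₀, hsum, ?_⟩
    intro ℓ L ρ Y f x₀ y₀ Ω Ξ _ _ prob _ G ξ _ _ hρ h hy₀ hgap hO
    refine ⟨?_, ?_⟩
    · rintro p rfl hb hg
      refine PesAdaGrad.reachesGap_of_lengthRule h hO hn hμ hμx hμy hρ hδ hη₀ hε₀ hε₀E hE hy₀ hgap
        (PesAdaGrad.one_le_epochLength hn hμ hμy hδ hη₀) hJ hb ?_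
      filter_upwards [hg] with ω hω k hk
      exact PesAdaGrad.budget_mul_max_le_epochLength hn hμ hμy hδ hα hα' hη₀ k (hω k hk)
    · rintro T p hT rfl hb hl
      exact PesAdaGrad.reachesGap_of_lengthRule h hO hn hμ hμx hμy hρ hδ hη₀ hε₀ hε₀E hE hy₀ hgap
        hT hJ hb hl
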